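/- **Setting.** Let $m\ge 0$, $a\in\mathbb R$, and put $q=r+ia\cos\theta$, $|q|^2=r^2+a^2\cos^2\theta$, $\Delta=r^2-2mr+a^2$, $\Sigma^2=(r^2+a^2)|q|^2+2mra^2\sin^2\theta$. Consider the Kerr metric in Boyer–Lindquist coordinates $(t,r,\theta,\varphi)$, $$\mathbf g=-\frac{|q|^2\Delta}{\Sigma^2}dt^2+\frac{\Sigma^2\sin^2\theta}{|q|^2}\Big(d\varphi-\frac{2amr}{\Sigma^2}dt\Big)^2+\frac{|q|^2}{\Delta}dr^2+|q|^2d\theta^2,$$ on an open set $U$ of coordinate values with $r>0$, $\Delta\ne0$, $0<\theta<\pi$, with Levi-Civita connection $\mathbf D$, scalar wave operator $\square_{\mathbf g}=\mathbf g^{\mu\nu}\mathbf D_\mu\mathbf D_\nu$ and curvature $\mathbf R(W,Z,X,Y)=\mathbf g(W,\mathbf D_X\mathbf D_YZ-\mathbf D_Y\mathbf D_XZ-\mathbf D_{[X,Y]}Z)$, and the principal null frame $$e_4=\tfrac{r^2+a^2}{\Delta}\partial_t+\partial_r+\tfrac a\Delta\partial_\varphi,\quad e_3=\tfrac{r^2+a^2}{|q|^2}\partial_t-\tfrac{\Delta}{|q|^2}\partial_r+\tfrac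 a{|q|^2}\partial_\varphi,\quad e_1=\tfrac1{|q|}\partial_\theta,\quad e_2=\tfrac{a\sin\theta}{|q|}\partial_t+\tfrac1{|q|\sin\theta}\partial_\varphi .$$ Indices $b,c,d$ run over $\{1,2\}$, repeated ones are summed, and $\in_{12}=-\in_{21}=1$, $\in_{11}=\in_{22}=0$. Let $$\chi_{bc}=\mathbf g(\mathbf D_be_4,e_c),\quad \underline\chi_{bc}=\mathbf g(\mathbf D_be_3,e_c),\quad \mathrm{tr}\chi=\chi_{bb},\quad {}^{(a)}\mathrm{tr}\chi=\in_{bc}\chi_{bc},\quad\mathrm{tr}\underline\chi=\underline\chi_{bb},\quad {}^{(a)}\mathrm{tr}\underline\chi=\in_{bc}\underline\chi_{bc},$$ $$\eta_b=\tfrac12\mathbf g(\mathbf D_3e_4,e_b),\quad\underline\eta_b=\tfrac12\mathbf g(\mathbf D_4e_3,e_b),\quad\zeta_b=\tfrac12\mathbf g(\mathbf D_be_4,e_3),\quad\omega=\tfrac14\mathbf g(\mathbf D_4e_4,e_3),\quad\underline\omega=\tfrac14\mathbf g(\mathbf D_3e_3,e_4),$$ $$\rho=\tfrac14\mathbf R(e_4,e_3,e_4,e_3),\qquad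 {}^*\rho=\tfrac12\mathbf R(e_1,e_2,e_3,e_4),\qquad P=\rho+i\,{}^*\rho,\qquad\Lambda=\tfrac{r^2+a^2}{|q|^3}\cot\theta,$$ $\mathrm{tr}X=\mathrm{tr}\chi-i\,{}^{(a)}\mathrm{tr}\chi$, $\mathrm{tr}\underline X=\mathrm{tr}\underline\chi-i\,{}^{(a)}\mathrm{tr}\underline\chi$, $H=\eta+i\,{}^*\eta$, $\underline H=\underline\eta+i\,{}^*\underline\eta$, with $({}^*\xi)_b=\in_{bc}\xi_c$. Let $\nabla_X$ be the horizontal covariant derivative on horizontal tensors (from $\nabla_Xe_b=\sum_c\mathbf g(\mathbf D_Xe_b,e_c)e_c$ and the Leibniz rule), and for a horizontal tensor of conformal type $s$ put ${}^{(c)}\nabla_3=\nabla_3-2s\underline\omega$ (result of type $s-1$), ${}^{(c)}\nabla_4=\nabla_4+2s\omega$ (result of type $s+1$), ${}^{(c)}\nabla_b=\nabla_b+s\zeta_b$, ${}^{(c)}\mathcal D_b={}^{(c)}\nabla_b+i\in_{bc}{}^{(c)}\nabla_c$, $\overline{{}^{(c)}\mathcal D}_b={}^{(c)}\nabla_b-i\in_{bc}{}^{(c)}\nabla_c$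 (both of type $s$). Let $(\xi\cdot U)_b=\xi_cU_{cb}$ and $(\xi\widehat\otimes\eta)_{bc}=\frac12(\xi_b\eta_c+\xi_c\eta_b-\delta_{bc}\,\xi\cdot\eta)$. Let $A\in\mathcal S_2(\mathbb C)$ be a complex horizontal 2-tensor on $U$ of class $C^2$ and of conformal type $2$, anti-self dual in the sense that $A=u+i\,{}^*u$ with $u$ real, symmetric, traceless and $({}^*u)_{bc}=\in_{bd}u_{dc}$. The tensorial Teukolsky operator is $$\begin{aligned}\mathcal L(A)=&-{}^{(c)}\nabla_4{}^{(c)}\nabla_3A+\tfrac12{}^{(c)}\mathcal D\widehat\otimes(\overline{{}^{(c)}\mathcal D}\cdot A)+\big(-\tfrac12\mathrm{tr}X-2\overline{\mathrm{tr}X}\big){}^{(c)}\nabla_3A-\tfrac12\mathrm{tr}\underline X\,{}^{(c)}\nabla_4A\\&+(4H+\underline H+\overline{\underline H})\cdot{}^{(c)}\nabla A+\big(-\overline{\mathrm{tr}X}\,\mathrm{tr}\underline X+2\overline P\big)A+2H\widehat\otimes(\overline{\underline H}\cdot A).\end{aligned}$$ **Statement.** Let $\mathfrak a=A_{11}=A(e_1,e_1)$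 and consider the scalar equation $$\square_{\mathbf g}\mathfrak a=\big(-4\underline\omega+i\,{}^{(a)}\mathrm{tr}\underline\chi\big)e_4(\mathfrak a)+\big(2\,\mathrm{tr}\chi+3i\,{}^{(a)}\mathrm{tr}\chi\big)e_3(\mathfrak a)+4i\underline\eta_2e_1(\mathfrak a)+\big(8\underline\eta_2-4i(\Lambda-\underline\eta_1)\big)e_2(\mathfrak a)+V\mathfrak a\qquad(\star)$$ with $$\begin{aligned}V=\;&4\Lambda^2+\tfrac12\mathrm{tr}\chi\,\mathrm{tr}\underline\chi-\tfrac52{}^{(a)}\mathrm{tr}\chi\,{}^{(a)}\mathrm{tr}\underline\chi-10\underline\omega\,\mathrm{tr}\chi-8\rho+2e_1(\underline\eta_1)-6\Lambda\underline\eta_1+8\underline\eta_1^2-16\underline\eta_2^2\\&+i\big({}^{(a)}\mathrm{tr}\chi\,\mathrm{tr}\underline\chi+{}^{(a)}\mathrm{tr}\underline\chi\,\mathrm{tr}\chi-10\underline\omega\,{}^{(a)}\mathrm{tr}\chi+4\,{}^*\rho+12\Lambda\underline\eta_2-8\underline\eta_1\underline\eta_2\big).\end{aligned}$$ 1. On $U$,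 $\mathcal L(A)_{11}$ equals the left-hand side minus the right-hand side of $(\star)$. Moreover $\mathcal L(A)=0$ on $U$ if and only if $\mathfrak a$ satisfies $(\star)$ on $U$. 2. At each point of $U$, $\mathfrak a$ satisfies $(\star)$ if and only if $\alpha^{[+2]}=-\frac{\overline q}{q}\mathfrak a$ satisfies the classical Teukolsky equation $$\begin{aligned}|q|^2\square_{\mathbf g}\alpha^{[+2]}=&-4(r-m)\partial_r\alpha^{[+2]}-4\Big(\frac{m(r^2-a^2)}\Delta-r-ia\cos\theta\Big)\partial_t\alpha^{[+2]}\\&-4\Big(\frac{a(r-m)}\Delta+i\frac{\cos\theta}{\sin^2\theta}\Big)\partial_\varphi\alpha^{[+2]}+(4\cot^2\theta-2)\alpha^{[+2]}.\end{aligned}$$ 3. The relation $\alpha^{[+2]}=-\frac{\overline q}{q}\mathfrak a$ is the one between the Newman–Penrose and the tensorial components of a Weyl tensor: if $W$ is a Weyl tensor at a point of $U$ (curvature symmetries, trace free), $\alpha_{bc}=W(e_4,e_b,e_4,e_c)$, $A(W)=\alpha+i\,{}^*\alpha$ and $n=\frac{|q|}{\sqrt2\,q}(e_1+ie_2)$,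 then $-W(e_4,n,e_4,n)=-\frac{\overline q}{q}A(W)_{11}$. -/

import Mathlib

noncomputable section

namespace KerrTeukolsky

/-! ### Tensor calculus in a coordinate chart of a four-dimensional space-time -/

/-- Points of a coordinate chart. For Boyer–Lindquist coordinates
`x 0 = t`, `x 1 = r`, `x 2 = θ`, `x 3 = φ`. -/
abbrev Pt := Fin 4 → ℝ

/-- Vector fields, by their coordinate components `X x μ = X^μ(x)`. -/
abbrev VF := Pt → Fin 4 → ℝ

/-- Metrics, by their coordinate components `g x μ ν = g_{μν}(x)`. -/
abbrev Metric := Pt → Matrix (Fin 4) (Fin 4) ℝ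

/-- The coordinate derivative `∂_μ f`. -/
def pd {F : Type*} [NormedAddCommGroup F] [NormedSpace ℝ F]
    (μ : Fin 4) (f : Pt → F) (x : Pt) : F :=
  fderiv ℝ f x (Pi.single μ 1)

/-- The derivative `X(f) = X^μ ∂_μ f` of a function along a vector field. -/
def along {F : Type*} [NormedAddCommGroup F] [NormedSpace ℝ F]
    (X : VF) (f : Pt → F) (x : Pt) : F :=
  ∑ μ, X x μ • pd μ f x

/-- `g(X, Y)`. -/
def ip (g : Metric) (X Y : VF) (x : Pt) : ℝ :=
  ∑ μ, ∑ ν, g x μ ν * X x μ * Y x ν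

/-- The Christoffel symbols `Γ^l_{μν}` of the Levi-Civita connection of `g`. -/
def christoffel (g : Metric) (l μ ν : Fin 4) (x : Pt) : ℝ :=
  (1 / 2) * ∑ k, (g x)⁻¹ l k *
    (pd μ (fun y => g y k ν) x + pd ν (fun y => g y k μ) x - pd k (fun y => g y μ ν) x)

/-- The Levi-Civita covariant derivative `D_X Y`. -/
def covD (g : Metric) (X Y : VF) : VF := fun x l =>
  along X (fun y => Y y l) x + ∑ μ, ∑ ν, christoffel g l μ ν x * X x μ * Y x ν

/-- The commutator `[X, Y]`. -/
def bracket (X Y : VF) : VF := fun x l =>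
  along X (fun y => Y y l) x - along Y (fun y => X y l) x

/-- The curvature `R(W, Z, X, Y) = g(W, D_X D_Y Z - D_Y D_X Z - D_[X,Y] Z)`. -/
def riem (g : Metric) (W Z X Y : VF) (x : Pt) : ℝ :=
  ip g W (fun y l => covD g X (covD g Y Z) y l - covD g Y (covD g X Z) y l
    - covD g (bracket X Y) Z y l) x

/-- The scalar wave operator `□_g f = g^{μν} (∂_μ ∂_ν f - Γ^l_{μν} ∂_l f)`. -/
def box (g : Metric) (f : Pt → ℂ) (x : Pt) : ℂ :=
  ∑ μ, ∑ ν, (((g x)⁻¹ μ ν : ℝ) : ℂ) *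
    (pd μ (fun y => pd ν f y) x - ∑ l, ((christoffel g l μ ν x : ℝ) : ℂ) * pd l f x)

/-! ### The horizontal structure of a null frame

A null frame is `e : Fin 4 → VF` with `e 0 = e_1`, `e 1 = e_2`, `e 2 = e_3`, `e 3 = e_4`, where
`(e_3, e_4)` is a null pair with `g(e_3, e_4) = -2` and `(e_1, e_2)` is an orthonormal, positively
oriented basis of the orthogonal complement (the horizontal space).  A horizontal covariant
tensor is given by its components relative to `(e_1, e_2)`. -/

/-- The inclusion of horizontal frame indices in frame indices. -/
def hz : Fin 2 → Fin 4 := ![0, 1]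

/-- The horizontal volume form `∈_{ab}`, with `∈_{12} = 1`. -/
def eps : Fin 2 → Fin 2 → ℝ := ![![0, 1], ![-1, 0]]

/-- Complex horizontal 1-forms. -/
abbrev HForm := Pt → Fin 2 → ℂ

/-- Complex horizontal covariant 2-tensors. -/
abbrev HTensor := Pt → Fin 2 → Fin 2 → ℂ

section Frame

variable (g : Metric) (e : Fin 4 → VF)

/-- `χ_{ab} = g(D_a e_4, e_b)`. -/
def chi (a b : Fin 2) (x : Pt) : ℝ := ip g (covD g (e (hz a)) (e 3)) (e (hz b)) x

/-- `χ̲_{ab} = g(D_a e_3, e_b)`. -/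
def chib (a b : Fin 2) (x : Pt) : ℝ := ip g (covD g (e (hz a)) (e 2)) (e (hz b)) x

/-- `tr χ = δ^{ab} χ_{ab}`. -/
def trChi (x : Pt) : ℝ := ∑ a, chi g e a a x

/-- `⁽ᵃ⁾tr χ = ∈^{ab} χ_{ab}`. -/
def atrChi (x : Pt) : ℝ := ∑ a, ∑ b, eps a b * chi g e a b x

/-- `tr χ̲ = δ^{ab} χ̲_{ab}`. -/
def trChib (x : Pt) : ℝ := ∑ a, chib g e a a x

/-- `⁽ᵃ⁾tr χ̲ = ∈^{ab} χ̲_{ab}`. -/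
def atrChib (x : Pt) : ℝ := ∑ a, ∑ b, eps a b * chib g e a b x

/-- `η_a = ½ g(D_3 e_4, e_a)`. -/
def eta (a : Fin 2) (x : Pt) : ℝ := (1 / 2) * ip g (covD g (e 2) (e 3)) (e (hz a)) x

/-- `η̲_a = ½ g(D_4 e_3, e_a)`. -/
def etab (a : Fin 2) (x : Pt) : ℝ := (1 / 2) * ip g (covD g (e 3) (e 2)) (e (hz a)) x

/-- `ζ_a = ½ g(D_a e_4, e_3)`. -/
def zeta (a : Fin 2) (x : Pt) : ℝ := (1 / 2) * ip g (covD g (e (hz a)) (e 3)) (e 2) x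

/-- `ω = ¼ g(D_4 e_4, e_3)`. -/
def om (x : Pt) : ℝ := (1 / 4) * ip g (covD g (e 3) (e 3)) (e 2) x

/-- `ω̲ = ¼ g(D_3 e_3, e_4)`. -/
def omb (x : Pt) : ℝ := (1 / 4) * ip g (covD g (e 2) (e 2)) (e 3) x

/-- `ρ = ¼ R(e_4, e_3, e_4, e_3)`. -/
def rho (x : Pt) : ℝ := (1 / 4) * riem g (e 3) (e 2) (e 3) (e 2) x

/-- `*ρ = ¼ *R(e_4, e_3, e_4, e_3)`, where `*R_{αβμν} = ½ ∈_{μν}^{ρσ} R_{αβρσ}`.  Since the volume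
form satisfies `½ ∈(e_1, e_2, e_3, e_4) = ∈_{12} = 1` and `g(e_3, e_4) = -2`, this is
`½ R(e_1, e_2, e_3, e_4)`. -/
def rhoDual (x : Pt) : ℝ := (1 / 2) * riem g (e 0) (e 1) (e 2) (e 3) x

/-- `tr X = tr χ - i ⁽ᵃ⁾tr χ`. -/
def trX (x : Pt) : ℂ := (trChi g e x : ℂ) - Complex.I * (atrChi g e x : ℂ)

/-- `tr X̲ = tr χ̲ - i ⁽ᵃ⁾tr χ̲`. -/
def trXb (x : Pt) : ℂ := (trChib g e x : ℂ) - Complex.I * (atrChib g e x : ℂ)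

/-- `P = ρ + i *ρ`. -/
def curvP (x : Pt) : ℂ := (rho g e x : ℂ) + Complex.I * (rhoDual g e x : ℂ)

/-- `H = η + i *η`, where `(*η)_a = ∈_{ab} η_b`. -/
def bigH : HForm := fun x a =>
  (eta g e a x : ℂ) + Complex.I * ∑ b, (eps a b : ℂ) * (eta g e b x : ℂ)

/-- `H̲ = η̲ + i *η̲`. -/
def bigHb : HForm := fun x a =>
  (etab g e a x : ℂ) + Complex.I * ∑ b, (eps a b : ℂ) * (etab g e b x : ℂ)

/-- The coefficients `g(D_X e_a, e_b)` of the horizontal connection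
`∇_X e_a = (D_X e_a)^⊥ = ∑_b g(D_X e_a, e_b) e_b`. -/
def hconn (X : VF) (a b : Fin 2) (x : Pt) : ℝ := ip g (covD g X (e (hz a))) (e (hz b)) x

/-- The horizontal covariant derivative of 1-forms,
`(∇_X F)(e_a) = X(F(e_a)) - F(∇_X e_a)`. -/
def nabla1 (X : VF) (F : HForm) : HForm := fun x a =>
  along X (fun y => F y a) x - ∑ c, (hconn g e X a c x : ℂ) * F x c

/-- The horizontal covariant derivative of 2-tensors,
`(∇_X U)(e_a, e_b) = X(U(e_a, e_b)) - U(∇_X e_a, e_b) - U(e_a, ∇_X e_b)`. -/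
def nabla2 (X : VF) (U : HTensor) : HTensor := fun x a b =>
  along X (fun y => U y a b) x - ∑ c, (hconn g e X a c x : ℂ) * U x c b
    - ∑ c, (hconn g e X b c x : ℂ) * U x a c

/-- The conformal derivative `⁽ᶜ⁾∇_3 U = ∇_3 U - 2 s ω̲ U` of a 2-tensor of conformal type `s`
(the result is of conformal type `s - 1`). -/
def cNabla3 (s : ℝ) (U : HTensor) : HTensor := fun x a b =>
  nabla2 g e (e 2) U x a b - 2 * (s : ℂ) * (omb g e x : ℂ) * U x a b

/-- The conformal derivative `⁽ᶜ⁾∇_4 U = ∇_4 U + 2 s ω U` of a 2-tensor of conformal type `s`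
(the result is of conformal type `s + 1`). -/
def cNabla4 (s : ℝ) (U : HTensor) : HTensor := fun x a b =>
  nabla2 g e (e 3) U x a b + 2 * (s : ℂ) * (om g e x : ℂ) * U x a b

/-- The conformal derivative `⁽ᶜ⁾∇_c F = ∇_c F + s ζ_c F` of a 1-form of conformal type `s`
(the result is of conformal type `s`). -/
def cNablaH1 (s : ℝ) (c : Fin 2) (F : HForm) : HForm := fun x a =>
  nabla1 g e (e (hz c)) F x a + (s : ℂ) * (zeta g e c x : ℂ) * F x a

/-- The conformal derivative `⁽ᶜ⁾∇_c U = ∇_c U + s ζ_c U` of a 2-tensor of conformal type `s`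
(the result is of conformal type `s`). -/
def cNablaH2 (s : ℝ) (c : Fin 2) (U : HTensor) : HTensor := fun x a b =>
  nabla2 g e (e (hz c)) U x a b + (s : ℂ) * (zeta g e c x : ℂ) * U x a b

/-- The complex derivative `⁽ᶜ⁾𝒟_a F_b = (⁽ᶜ⁾∇ + i *⁽ᶜ⁾∇)_a F_b` of a 1-form. -/
def cD1 (s : ℝ) (F : HForm) : HTensor := fun x a b =>
  cNablaH1 g e s a F x b + Complex.I * ∑ c, (eps a c : ℂ) * cNablaH1 g e s c F x b

/-- `⁽ᶜ⁾𝒟 ⊗̂ F`, with the normalisation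
`(ξ ⊗̂ η)_{ab} = ½ (ξ_a η_b + ξ_b η_a - δ_{ab} ξ·η)`. -/
def cDHat (s : ℝ) (F : HForm) : HTensor := fun x a b =>
  (1 / 2) * (cD1 g e s F x a b + cD1 g e s F x b a
    - (if a = b then ∑ c, cD1 g e s F x c c else 0))

/-- The divergence `(⁽ᶜ⁾𝒟̄ · U)_a = δ^{bc} (⁽ᶜ⁾∇ - i *⁽ᶜ⁾∇)_b U_{ca}` of a 2-tensor. -/
def cDbarDiv (s : ℝ) (U : HTensor) : HForm := fun x a =>
  ∑ b, (cNablaH2 g e s b U x b a - Complex.I * ∑ c, (eps b c : ℂ) * cNablaH2 g e s c U x b a)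

/-- `2 H ⊗̂ (H̲̄ · U)`, where `(ξ · U)_a = ξ_b U_{ab}`. -/
def HHbU (U : HTensor) : HTensor := fun x a b =>
  let v : Fin 2 → ℂ := fun c => ∑ d, (starRingEnd ℂ) (bigHb g e x d) * U x c d
  2 * ((1 / 2) * (bigH g e x a * v b + bigH g e x b * v a
    - (if a = b then ∑ c, bigH g e x c * v c else 0)))

/-- The tensorial Teukolsky operator, for `A` of conformal type `2`:
`ℒ(A) = -⁽ᶜ⁾∇_4 ⁽ᶜ⁾∇_3 A + ½ ⁽ᶜ⁾𝒟 ⊗̂ (⁽ᶜ⁾𝒟̄ · A) + (-½ tr X - 2 tr X̄) ⁽ᶜ⁾∇_3 A - ½ tr X̲ ⁽ᶜ⁾∇_4 A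
  + (4H + H̲ + H̲̄) · ⁽ᶜ⁾∇ A + (-tr X̄ tr X̲ + 2 P̄) A + 2 H ⊗̂ (H̲̄ · A)`. -/
def teukolskyOp (A : HTensor) : HTensor := fun x a b =>
  - cNabla4 g e 1 (cNabla3 g e 2 A) x a b
  + (1 / 2) * cDHat g e 2 (cDbarDiv g e 2 A) x a b
  + (-(1 / 2) * trX g e x - 2 * (starRingEnd ℂ) (trX g e x)) * cNabla3 g e 2 A x a b
  - (1 / 2) * trXb g e x * cNabla4 g e 2 A x a b
  + ∑ c, (4 * bigH g e x c + bigHb g e x c + (starRingEnd ℂ) (bigHb g e x c))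
      * cNablaH2 g e 2 c A x a b
  + (-((starRingEnd ℂ) (trX g e x)) * trXb g e x + 2 * (starRingEnd ℂ) (curvP g e x)) * A x a b
  + HHbU g e A x a b

end Frame

/-- Membership in `𝒮_2(ℂ)` at a point: `U = u + i *u` with `u` a real symmetric traceless
horizontal 2-tensor and `(*u)_{ab} = ∈_{ac} u_{cb}`. -/
def IsAntiSelfDual (U : Fin 2 → Fin 2 → ℂ) : Prop :=
  ∃ u : Fin 2 → Fin 2 → ℝ, (∀ a b, u a b = u b a) ∧ ∑ a, u a a = 0 ∧
    ∀ a b, U a b = (u a b : ℂ) + Complex.I * ∑ c, (eps a c : ℂ) * (u c b : ℂ)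

/-- Weyl tensors at a point where the metric is `g`: covariant 4-tensors with the symmetries of
the curvature tensor and vanishing traces. -/
structure IsWeyl (g : Matrix (Fin 4) (Fin 4) ℝ) (W : Fin 4 → Fin 4 → Fin 4 → Fin 4 → ℝ) :
    Prop where
  antisymm_left : ∀ α β μ ν, W α β μ ν = -W β α μ ν
  antisymm_right : ∀ α β μ ν, W α β μ ν = -W α β ν μ
  pair_symm : ∀ α β μ ν, W α β μ ν = W μ ν α β
  cyclic : ∀ α β μ ν, W α β μ ν + W α μ ν β + W α ν β μ = 0
  trace_free : ∀ α μ, ∑ β, ∑ ν, g⁻¹ β ν * W α β μ ν = 0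

/-- The complex-multilinear evaluation `W(X, Y, Z, T)` on complex tangent vectors. -/
def evalC (W : Fin 4 → Fin 4 → Fin 4 → Fin 4 → ℝ) (X Y Z T : Fin 4 → ℂ) : ℂ :=
  ∑ α, ∑ β, ∑ μ, ∑ ν, (W α β μ ν : ℂ) * X α * Y β * Z μ * T ν

/-- A real vector regarded as a complex one. -/
def toC (X : Fin 4 → ℝ) : Fin 4 → ℂ := fun μ => (X μ : ℂ)

/-- The null component `A(W) = α + i *α`, where `α_{ab} = W(e_4, e_a, e_4, e_b)`, at the point `x`. -/
def nullA (e : Fin 4 → VF) (W : Fin 4 → Fin 4 → Fin 4 → Fin 4 → ℝ) (x : Pt) :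
    Fin 2 → Fin 2 → ℂ := fun a b =>
  let al : Fin 2 → Fin 2 → ℂ := fun c d =>
    evalC W (toC (e 3 x)) (toC (e (hz c) x)) (toC (e 3 x)) (toC (e (hz d) x))
  al a b + Complex.I * ∑ c, (eps a c : ℂ) * al c b

/-! ### The Kerr metric and its principal null frame in Boyer–Lindquist coordinates -/

section Kerr

variable (m a : ℝ)

/-- `q = r + i a cos θ`. -/
def q (x : Pt) : ℂ := (x 1 : ℂ) + Complex.I * ((a * Real.cos (x 2) : ℝ) : ℂ)

/-- `Δ = r² - 2 m r + a²`. -/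
def Del (x : Pt) : ℝ := x 1 ^ 2 - 2 * m * x 1 + a ^ 2

/-- `|q|² = r² + a² cos² θ`. -/
def qSq (x : Pt) : ℝ := x 1 ^ 2 + a ^ 2 * Real.cos (x 2) ^ 2

/-- `|q|`. -/
def qAbs (x : Pt) : ℝ := √(qSq a x)

/-- `Σ² = (r² + a²) |q|² + 2 m r a² sin² θ`. -/
def SigSq (x : Pt) : ℝ :=
  (x 1 ^ 2 + a ^ 2) * qSq a x + 2 * m * x 1 * a ^ 2 * Real.sin (x 2) ^ 2

/-- The set of Boyer–Lindquist coordinate values at which the coordinates, the metric and the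
null frame are regular: `r > 0`, `Δ ≠ 0`, `0 < θ < π`. It contains the whole exterior region of the
Kerr space-time minus the axis. -/
def patch : Set Pt := {x | 0 < x 1 ∧ Del m a x ≠ 0 ∧ 0 < x 2 ∧ x 2 < Real.pi}

/-- The Kerr metric
`g = -(|q|²Δ/Σ²) dt² + (Σ² sin²θ/|q|²) (dφ - (2amr/Σ²) dt)² + (|q|²/Δ) dr² + |q|² dθ²`. -/
def kerr : Metric := fun x =>
  let k := SigSq m a x * Real.sin (x 2) ^ 2 / qSq a x
  let w := 2 * a * m * x 1 / SigSq m a x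
  !![-(qSq a x * Del m a x / SigSq m a x) + k * w ^ 2, 0, 0, -(k * w);
     0, qSq a x / Del m a x, 0, 0;
     0, 0, qSq a x, 0;
     -(k * w), 0, 0, k]

/-- The principal null frame `(e_1, e_2, e_3, e_4)`:
`e_1 = |q|⁻¹ ∂_θ`, `e_2 = (a sin θ/|q|) ∂_t + (|q| sin θ)⁻¹ ∂_φ`,
`e_3 = ((r² + a²)/|q|²) ∂_t - (Δ/|q|²) ∂_r + (a/|q|²) ∂_φ`,
`e_4 = ((r² + a²)/Δ) ∂_t + ∂_r + (a/Δ) ∂_φ`. -/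
def frame : Fin 4 → VF :=
  ![fun x => ![0, 0, 1 / qAbs a x, 0],
    fun x => ![a * Real.sin (x 2) / qAbs a x, 0, 0, 1 / (qAbs a x * Real.sin (x 2))],
    fun x => ![(x 1 ^ 2 + a ^ 2) / qSq a x, -(Del m a x / qSq a x), 0, a / qSq a x],
    fun x => ![(x 1 ^ 2 + a ^ 2) / Del m a x, 1, 0, a / Del m a x]]

/-- `Λ = ((r² + a²)/|q|³) cot θ`. -/
def Lam (x : Pt) : ℝ := (x 1 ^ 2 + a ^ 2) / qAbs a x ^ 3 * Real.cot (x 2)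

/-- The real part of the potential,
`4Λ² + ½ trχ trχ̲ - (5/2) ⁽ᵃ⁾trχ ⁽ᵃ⁾trχ̲ - 10 ω̲ trχ - 8ρ + 2 e_1(η̲_1) - 6 Λ η̲_1 + 8 η̲_1² - 16 η̲_2²`. -/
def potRe (x : Pt) : ℝ :=
  let g := kerr m a
  let e := frame m a
  4 * Lam a x ^ 2 + (1 / 2) * trChi g e x * trChib g e x - (5 / 2) * atrChi g e x * atrChib g e x
    - 10 * omb g e x * trChi g e x - 8 * rho g e x + 2 * along (e 0) (etab g e 0) x
    - 6 * Lam a x * etab g e 0 x + 8 * etab g e 0 x ^ 2 - 16 * etab g e 1 x ^ 2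

/-- The imaginary part of the potential,
`⁽ᵃ⁾trχ trχ̲ + ⁽ᵃ⁾trχ̲ trχ - 10 ω̲ ⁽ᵃ⁾trχ + 4 *ρ + 12 Λ η̲_2 - 8 η̲_1 η̲_2`. -/
def potIm (x : Pt) : ℝ :=
  let g := kerr m a
  let e := frame m a
  atrChi g e x * trChib g e x + atrChib g e x * trChi g e x - 10 * omb g e x * atrChi g e x
    + 4 * rhoDual g e x + 12 * Lam a x * etab g e 1 x - 8 * etab g e 0 x * etab g e 1 x

/-- The potential `V`. -/
def potV (x : Pt) : ℂ := (potRe m a x : ℂ) + Complex.I * (potIm m a x : ℂ)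

/-- The right-hand side of the scalar wave equation,
`(-4ω̲ + i ⁽ᵃ⁾trχ̲) e_4(f) + (2 trχ + 3i ⁽ᵃ⁾trχ) e_3(f) + 4i η̲_2 e_1(f)
  + (8η̲_2 - 4i(Λ - η̲_1)) e_2(f) + V f`. -/
def waveRHS (f : Pt → ℂ) (x : Pt) : ℂ :=
  let g := kerr m a
  let e := frame m a
  (-4 * (omb g e x : ℂ) + Complex.I * (atrChib g e x : ℂ)) * along (e 3) f x
    + (2 * (trChi g e x : ℂ) + 3 * Complex.I * (atrChi g e x : ℂ)) * along (e 2) f x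
    + 4 * Complex.I * (etab g e 1 x : ℂ) * along (e 0) f x
    + (8 * (etab g e 1 x : ℂ) - 4 * Complex.I * ((Lam a x : ℂ) - (etab g e 0 x : ℂ)))
        * along (e 1) f x
    + potV m a x * f x

/-- The right-hand side of the classical Teukolsky equation of spin `+2` for `|q|² □_g f`,
`-4(r-m) ∂_r f - 4(m(r²-a²)/Δ - r - i a cos θ) ∂_t f - 4(a(r-m)/Δ + i cos θ/sin² θ) ∂_φ f
  + (4 cot² θ - 2) f`. -/
def teukolskyRHS (f : Pt → ℂ) (x : Pt) : ℂ :=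
  -4 * ((x 1 - m : ℝ) : ℂ) * pd 1 f x
    - 4 * (((m * (x 1 ^ 2 - a ^ 2) / Del m a x - x 1 : ℝ) : ℂ)
        - Complex.I * ((a * Real.cos (x 2) : ℝ) : ℂ)) * pd 0 f x
    - 4 * (((a * (x 1 - m) / Del m a x : ℝ) : ℂ)
        + Complex.I * ((Real.cos (x 2) / Real.sin (x 2) ^ 2 : ℝ) : ℂ)) * pd 3 f x
    + ((4 * Real.cot (x 2) ^ 2 - 2 : ℝ) : ℂ) * f x

/-- The rescaled scalar `-(q̄/q) f`. -/
def alphaOf (f : Pt → ℂ) (x : Pt) : ℂ := -((starRingEnd ℂ) (q a x) / q a x) * f x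

/-- The complex null vector `(|q|/(√2 q)) (e_1 + i e_2)` of the Newman–Penrose tetrad. -/
def npM (x : Pt) : Fin 4 → ℂ := fun μ =>
  ((qAbs a x : ℝ) : ℂ) / (((√2 : ℝ) : ℂ) * q a x)
    * (((frame m a 0 x μ : ℝ) : ℂ) + Complex.I * ((frame m a 1 x μ : ℝ) : ℂ))

/-- The Newman–Penrose scalar `α^{[+2]} = -W(l, n, l, n)` of a Weyl tensor at `x`, where `l = e_4` and
`n` is the complex null vector `npM`. -/
def alphaNP (W : Fin 4 → Fin 4 → Fin 4 → Fin 4 → ℝ) (x : Pt) : ℂ :=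
  -evalC W (toC (frame m a 3 x)) (npM m a x) (toC (frame m a 3 x)) (npM m a x)

end Kerr

end KerrTeukolsky

end

open Topology

noncomputable section

namespace KerrTeukolsky

/-! ### Calculus of the Levi-Civita connection in a chart -/

section Calculus

variable {F : Type*} [NormedAddCommGroup F] [NormedSpace ℝ F]

/-! All geometry is done in the principal null frame, without computing Christoffel symbols or the
inverse of the Kerr metric. Metric compatibility and vanishing torsion make the connection
coefficients of a null frame the unique array that is skew in its last two indices and whose
antisymmetrisation gives the commutators (`koszul`, `ip_covD_frame`). So the explicit table `ricci`
is certified by six commutators (`bracket_frame_of_lt`). The curvature components (`riem_frame`) and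
the wave operator (`box_frame`) then follow from that table.

An anti-self dual symmetric traceless tensor is a single complex function times a fixed basis
tensor. The horizontal connection is a rotation and this basis tensor is an eigenvector of it, so
every term of the Teukolsky operator preserves the form "scalar times basis tensor"
(`teukolskyOp_asd`). This leaves a scalar operator. Its second order part differs from that of the
wave operator only by the commutators of (e_1, e_2) and of (e_3, e_4), its first order terms match
by inspection, and its potential matches thanks to two real identities between curvature and
derivatives of connection coefficients (`potential_identity_re`, `potential_identity_im`). This is
`teukolskyScalar_kerr`. Since all components of the tensor equation are constant multiples of one
scalar, the tensor equation and the scalar equation are equivalent.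

For the classical equation, the factor p = -q̄/q is unimodular with explicit imaginary logarithmic
derivatives along the frame. Conjugating the scalar operator by p and comparing the coefficients of
the coordinate derivatives gives an exact operator identity (`teukolsky_phase`) with the
nonvanishing factor |q|² p, hence a pointwise equivalence. The statement on Weyl tensors
(`alphaNP_eq`) is algebra: the trace condition makes α traceless, and the square of the normalising
factor of n is q̄/(2q). -/

theorem pd_congr {μ : Fin 4} {f h : Pt → F} {x : Pt} (H : f =ᶠ[𝓝 x] h) : pd μ f x = pd μ h x := by
  simp only [pd, H.fderiv_eq]

theorem along_congr {X : VF} {f h : Pt → F} {x : Pt} (H : f =ᶠ[𝓝 x] h) :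
    along X f x = along X h x := by
  simp only [along, pd_congr H]

theorem pd_const (μ : Fin 4) (c : F) (x : Pt) : pd μ (fun _ => c) x = 0 := by
  simp [pd]

theorem along_const (X : VF) (c : F) (x : Pt) : along X (fun _ => c) x = 0 := by
  simp [along, pd_const]

theorem pd_add {μ : Fin 4} {f h : Pt → F} {x : Pt} (hf : DifferentiableAt ℝ f x)
    (hh : DifferentiableAt ℝ h x) : pd μ (fun y => f y + h y) x = pd μ f x + pd μ h x := by
  simp [pd, fderiv_fun_add hf hh]

theorem along_add {X : VF} {f h : Pt → F} {x : Pt} (hf : DifferentiableAt ℝ f x)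
    (hh : DifferentiableAt ℝ h x) : along X (fun y => f y + h y) x = along X f x + along X h x := by
  simp [along, pd_add hf hh, Finset.sum_add_distrib]

theorem pd_sum {ι : Type*} {s : Finset ι} {μ : Fin 4} {f : ι → Pt → F} {x : Pt}
    (hf : ∀ i ∈ s, DifferentiableAt ℝ (f i) x) :
    pd μ (fun y => ∑ i ∈ s, f i y) x = ∑ i ∈ s, pd μ (f i) x := by
  simp [pd, fderiv_fun_sum hf]

theorem along_sum {ι : Type*} {s : Finset ι} {X : VF} {f : ι → Pt → F} {x : Pt}
    (hf : ∀ i ∈ s, DifferentiableAt ℝ (f i) x) :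
    along X (fun y => ∑ i ∈ s, f i y) x = ∑ i ∈ s, along X (f i) x := by
  simp only [along, pd_sum hf, Finset.smul_sum]
  exact Finset.sum_comm

theorem pd_mul {𝕜 : Type*} [NormedCommRing 𝕜] [NormedAlgebra ℝ 𝕜] {μ : Fin 4} {f h : Pt → 𝕜}
    {x : Pt} (hf : DifferentiableAt ℝ f x) (hh : DifferentiableAt ℝ h x) :
    pd μ (fun y => f y * h y) x = f x * pd μ h x + h x * pd μ f x := by
  simp [pd, fderiv_fun_mul hf hh]

theorem along_mul {𝕜 : Type*} [NormedCommRing 𝕜] [NormedAlgebra ℝ 𝕜] {X : VF} {f h : Pt → 𝕜}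
    {x : Pt} (hf : DifferentiableAt ℝ f x) (hh : DifferentiableAt ℝ h x) :
    along X (fun y => f y * h y) x = f x * along X h x + h x * along X f x := by
  simp only [along, pd_mul hf hh, smul_add, Finset.sum_add_distrib, Finset.mul_sum,
    mul_smul_comm]

/-- Only the value of the direction field at the point matters. This lets frame expansions of
brackets and covariant derivatives, known at one point, act on functions. -/
theorem along_sum_smul {ι : Type*} (s : Finset ι) (c : ι → ℝ) (X : ι → VF) (Y : VF) (f : Pt → F)
    {x : Pt} (hY : Y x = ∑ k ∈ s, c k • X k x) :
    along Y f x = ∑ k ∈ s, c k • along (X k) f x := by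
  simp only [along, hY, Finset.sum_apply, Pi.smul_apply, smul_eq_mul, Finset.sum_smul,
    Finset.smul_sum, mul_smul]
  exact Finset.sum_comm

end Calculus

/-! ### Torsion-freeness and metric compatibility of the Christoffel connection. -/

section LeviCivita

variable {g : Metric} {x : Pt}

theorem mul_inv_sum {M : Matrix (Fin 4) (Fin 4) ℝ} (hM : IsUnit M.det) (T : Fin 4 → ℝ)
    (k : Fin 4) : ∑ l, M k l * ((1 / 2) * ∑ j, M⁻¹ l j * T j) = (1 / 2) * T k := by
  have h : (M.mulVec (M⁻¹.mulVec T)) k = T k := by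
    rw [Matrix.mulVec_mulVec, Matrix.mul_nonsing_inv _ hM, Matrix.one_mulVec]
  rw [← h]
  simp only [Matrix.mulVec, dotProduct, Finset.mul_sum]
  exact Finset.sum_congr rfl fun l _ => Finset.sum_congr rfl fun j _ => by ring

theorem lower_christoffel (hM : IsUnit (g x).det) (k μ ν : Fin 4) :
    ∑ l, g x k l * christoffel g l μ ν x = (1 / 2) *
      (pd μ (fun y => g y k ν) x + pd ν (fun y => g y k μ) x - pd k (fun y => g y μ ν) x) :=
  mul_inv_sum hM _ k

theorem christoffel_symm (hs : ∀ y, (g y).IsSymm) (l μ ν : Fin 4) :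
    christoffel g l μ ν x = christoffel g l ν μ x := by
  simp only [christoffel]
  congr 1
  refine Finset.sum_congr rfl fun k _ => ?_
  have : (fun y => g y μ ν) = fun y => g y ν μ := funext fun y => (hs y).apply ν μ
  rw [this]
  ring

theorem ip_symm (hs : ∀ y, (g y).IsSymm) (X Y : VF) : ip g X Y x = ip g Y X x := by
  simp only [ip]
  rw [Finset.sum_comm]
  refine Finset.sum_congr rfl fun μ _ => Finset.sum_congr rfl fun ν _ => ?_
  rw [(hs x).apply μ ν]
  ring

/-- Vanishing torsion: the Christoffel terms are symmetric in their lower indices and cancel. It is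
one of the two inputs of the Koszul argument. -/
theorem covD_sub_covD (hs : ∀ y, (g y).IsSymm) (X Y : VF) (l : Fin 4) :
    covD g X Y x l - covD g Y X x l = bracket X Y x l := by
  simp only [covD, bracket]
  have : ∑ μ, ∑ ν, christoffel g l μ ν x * Y x μ * X x ν =
      ∑ μ, ∑ ν, christoffel g l μ ν x * X x μ * Y x ν := by
    rw [Finset.sum_comm]
    refine Finset.sum_congr rfl fun μ _ => Finset.sum_congr rfl fun ν _ => ?_
    rw [christoffel_symm hs l ν μ]
    ring
  rw [this]
  ring

/-- Pairing with a vector lowers the Christoffel index, so the inverse metric disappears and only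
first derivatives of the metric remain. -/
theorem ip_covD (hM : IsUnit (g x).det) (hs : ∀ y, (g y).IsSymm) (Z X Y : VF) :
    ip g (covD g Z X) Y x = (∑ l, ∑ ν, g x l ν * along Z (fun y => X y l) x * Y x ν) +
      ∑ ν, ∑ μ, ∑ κ, (1 / 2) * (pd μ (fun y => g y ν κ) x + pd κ (fun y => g y ν μ) x
        - pd ν (fun y => g y μ κ) x) * Z x μ * X x κ * Y x ν := by
  have key : ∀ ν, ∑ l, g x l ν * ∑ μ, ∑ κ, christoffel g l μ κ x * Z x μ * X x κ =
      ∑ μ, ∑ κ, (1 / 2) * (pd μ (fun y => g y ν κ) x + pd κ (fun y => g y ν μ) x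
        - pd ν (fun y => g y μ κ) x) * Z x μ * X x κ := by
    intro ν
    simp only [Finset.mul_sum]
    rw [Finset.sum_comm]
    refine Finset.sum_congr rfl fun μ _ => ?_
    rw [Finset.sum_comm]
    refine Finset.sum_congr rfl fun κ _ => ?_
    rw [← lower_christoffel hM, Finset.sum_mul, Finset.sum_mul]
    refine Finset.sum_congr rfl fun l _ => ?_
    rw [(hs x).apply ν l]
    ring
  simp only [ip, covD, mul_add, add_mul, Finset.sum_add_distrib]
  congr 1
  rw [Finset.sum_comm]
  refine Finset.sum_congr rfl fun ν _ => ?_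
  rw [← Finset.sum_mul, key ν, Finset.sum_mul]
  refine Finset.sum_congr rfl fun μ _ => ?_
  rw [Finset.sum_mul]

/-- Metric compatibility, the other input of the Koszul argument. -/
theorem along_ip (hM : IsUnit (g x).det) (hs : ∀ y, (g y).IsSymm)
    (hg : ∀ μ ν, DifferentiableAt ℝ (fun y => g y μ ν) x) (Z X Y : VF)
    (hX : ∀ l, DifferentiableAt ℝ (fun y => X y l) x)
    (hY : ∀ l, DifferentiableAt ℝ (fun y => Y y l) x) :
    along Z (ip g X Y) x = ip g (covD g Z X) Y x + ip g (covD g Z Y) X x := by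
  have h1 : along Z (ip g X Y) x = ∑ κ, ∑ ν, (g x κ ν * X x κ * along Z (fun y => Y y ν) x +
      g x κ ν * along Z (fun y => X y κ) x * Y x ν +
      along Z (fun y => g y κ ν) x * X x κ * Y x ν) := by
    change along Z (fun y => ∑ κ, ∑ ν, g y κ ν * X y κ * Y y ν) x = _
    rw [along_sum (f := fun κ y => ∑ ν, g y κ ν * X y κ * Y y ν)
      (fun κ _ => DifferentiableAt.fun_sum fun ν _ => ((hg κ ν).mul (hX κ)).mul (hY ν))]
    refine Finset.sum_congr rfl fun κ _ => ?_
    rw [along_sum (f := fun ν y => g y κ ν * X y κ * Y y ν)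
      (fun ν _ => ((hg κ ν).mul (hX κ)).mul (hY ν))]
    refine Finset.sum_congr rfl fun ν _ => ?_
    rw [along_mul (f := fun y => g y κ ν * X y κ) ((hg κ ν).mul (hX κ)) (hY ν),
      along_mul (hg κ ν) (hX κ)]
    ring
  have hsd : ∀ k μ ν, pd k (fun y => g y μ ν) x = pd k (fun y => g y ν μ) x := by
    intro k μ ν
    congr 1
    exact funext fun y => (hs y).apply ν μ
  rw [h1, ip_covD hM hs, ip_covD hM hs]
  have h2 : ∑ l, ∑ ν, g x l ν * along Z (fun y => Y y l) x * X x ν =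
      ∑ κ, ∑ ν, g x κ ν * X x κ * along Z (fun y => Y y ν) x := by
    rw [Finset.sum_comm]
    refine Finset.sum_congr rfl fun μ _ => Finset.sum_congr rfl fun ν _ => ?_
    rw [(hs x).apply μ ν]
    ring
  have h3 : ∑ κ, ∑ ν, along Z (fun y => g y κ ν) x * X x κ * Y x ν =
      ∑ κ, ∑ ν, ∑ μ, pd μ (fun y => g y κ ν) x * Z x μ * X x κ * Y x ν := by
    refine Finset.sum_congr rfl fun μ _ => Finset.sum_congr rfl fun ν _ => ?_
    simp only [along, Finset.sum_mul, smul_eq_mul]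
    exact Finset.sum_congr rfl fun μ _ => by ring
  simp only [Finset.sum_add_distrib]
  rw [h2, h3]
  have h4 : ∑ ν, ∑ μ, ∑ κ, (1 / 2) * (pd μ (fun y => g y ν κ) x + pd κ (fun y => g y ν μ) x
        - pd ν (fun y => g y μ κ) x) * Z x μ * X x κ * Y x ν =
      ∑ κ, ∑ ν, ∑ μ, (1 / 2) * (pd μ (fun y => g y ν κ) x + pd κ (fun y => g y ν μ) x
        - pd ν (fun y => g y μ κ) x) * Z x μ * X x κ * Y x ν := by
    rw [Finset.sum_comm' (t' := Finset.univ) (s' := fun _ => Finset.univ) (by simp)]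
    rw [Finset.sum_congr rfl fun μ _ => Finset.sum_comm]
    rw [Finset.sum_comm]
    exact Finset.sum_congr rfl fun κ _ => Finset.sum_comm
  have h5 : ∑ ν, ∑ μ, ∑ κ, (1 / 2) * (pd μ (fun y => g y ν κ) x + pd κ (fun y => g y ν μ) x
        - pd ν (fun y => g y μ κ) x) * Z x μ * Y x κ * X x ν =
      ∑ κ, ∑ ν, ∑ μ, (1 / 2) * (pd μ (fun y => g y κ ν) x + pd ν (fun y => g y κ μ) x
        - pd κ (fun y => g y μ ν) x) * Z x μ * Y x ν * X x κ :=
    Finset.sum_congr rfl fun κ _ => Finset.sum_comm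
  rw [h4, h5]
  -- The two Christoffel symbols of the first kind add up to ∂_μ g_{κν}; their other terms cancel by
  -- symmetry of the metric.
  have h6 : ∑ κ, ∑ ν, ∑ μ, pd μ (fun y => g y κ ν) x * Z x μ * X x κ * Y x ν =
      (∑ κ, ∑ ν, ∑ μ, (1 / 2) * (pd μ (fun y => g y ν κ) x + pd κ (fun y => g y ν μ) x
        - pd ν (fun y => g y μ κ) x) * Z x μ * X x κ * Y x ν) +
      ∑ κ, ∑ ν, ∑ μ, (1 / 2) * (pd μ (fun y => g y κ ν) x + pd ν (fun y => g y κ μ) x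
        - pd κ (fun y => g y μ ν) x) * Z x μ * Y x ν * X x κ := by
    simp only [← Finset.sum_add_distrib]
    refine Finset.sum_congr rfl fun κ _ => Finset.sum_congr rfl fun ν _ =>
      Finset.sum_congr rfl fun μ _ => ?_
    rw [hsd μ ν κ, hsd κ ν μ, hsd ν μ κ]
    ring
  rw [h6]
  ring

end LeviCivita

/-! ### Null frames -/

/-- The Gram matrix of a null frame. -/
def nullGram : Matrix (Fin 4) (Fin 4) ℝ := !![1, 0, 0, 0; 0, 1, 0, 0; 0, 0, 0, -2; 0, 0, -2, 0]

/-- The inverse of the Gram matrix of a null frame. -/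
def nullGramInv : Matrix (Fin 4) (Fin 4) ℝ :=
  !![1, 0, 0, 0; 0, 1, 0, 0; 0, 0, 0, -(1 / 2); 0, 0, -(1 / 2), 0]

theorem nullGram_mul_inv : nullGram * nullGramInv = 1 := by
  ext i j
  fin_cases i <;> fin_cases j <;>
    simp [nullGram, nullGramInv, Matrix.mul_apply, Fin.sum_univ_four]

/-- Raising a frame index. -/
def raise (w : Fin 4 → ℝ) : Fin 4 → ℝ := ![w 0, w 1, -(1 / 2) * w 3, -(1 / 2) * w 2]

theorem raise_eq (w : Fin 4 → ℝ) : raise w = nullGramInv.mulVec w := by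
  ext i
  fin_cases i <;> simp [raise, nullGramInv, Matrix.mulVec, dotProduct, Fin.sum_univ_four]

theorem sum_raise_mul_nullGram (w : Fin 4 → ℝ) (l : Fin 4) :
    ∑ k, raise w k * nullGram k l = w l := by
  fin_cases l <;> simp [raise, nullGram, Fin.sum_univ_four] <;> ring

/-- The frame `e` is a null frame near `x`, in a chart in which the metric is differentiable. -/
structure NullFrameAt (g : Metric) (e : Fin 4 → VF) (x : Pt) : Prop where
  symm : ∀ y, (g y).IsSymm
  gram : ∀ᶠ y in 𝓝 x, ∀ i j, ip g (e i) (e j) y = nullGram i j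
  diff_metric : ∀ μ ν, DifferentiableAt ℝ (fun y => g y μ ν) x
  diff_frame : ∀ i l, DifferentiableAt ℝ (fun y => e i y l) x

/-- The difference of the two arrays is symmetric in its first two indices and skew in its last two.
Such an array vanishes, as one sees by running through the cyclic permutations of the indices. -/
theorem koszul {G K : Fin 4 → Fin 4 → Fin 4 → ℝ} (hG : ∀ i j k, G i j k = -G i k j)
    (hK : ∀ i j k, K i j k = -K i k j)
    (h : ∀ i j k, G i j k - G j i k = K i j k - K j i k) (i j k : Fin 4) : G i j k = K i j k := by
  have := hG i j k; have := hG j k i; have := hG k i j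
  have := hK i j k; have := hK j k i; have := hK k i j
  have := h i j k; have := h j k i; have := h k i j
  linarith

section Frame

variable {g : Metric} {e : Fin 4 → VF} {x : Pt}

theorem frame_gram_matrix (h : ∀ i j, ip g (e i) (e j) x = nullGram i j) :
    (Matrix.of fun i => e i x) * g x * (Matrix.of fun i => e i x).transpose = nullGram := by
  ext i j
  rw [← h i j]
  simp only [ip, Matrix.mul_apply, Matrix.of_apply, Matrix.transpose_apply, Finset.sum_mul]
  rw [Finset.sum_comm]
  exact Finset.sum_congr rfl fun μ _ => Finset.sum_congr rfl fun ν _ => by ring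

/-- Take determinants in E g Eᵀ = N, where the rows of E are the frame vectors. Nondegeneracy of the
metric thus comes from the frame, with no determinant of the metric to compute. -/
theorem frame_det (h : ∀ i j, ip g (e i) (e j) x = nullGram i j) :
    IsUnit (Matrix.of fun i => e i x).det ∧ IsUnit (g x).det := by
  have h1 := congrArg Matrix.det (frame_gram_matrix h)
  have h2 : IsUnit nullGram.det :=
    (Matrix.isUnit_iff_isUnit_det _).1 (IsUnit.of_mul_eq_one _ nullGram_mul_inv)
  rw [← h1, Matrix.det_mul, Matrix.det_mul] at h2
  exact ⟨isUnit_of_mul_isUnit_left (isUnit_of_mul_isUnit_left h2),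
    isUnit_of_mul_isUnit_right (isUnit_of_mul_isUnit_left h2)⟩

/-- From E g Eᵀ = N one reads off g⁻¹ = Eᵀ N⁻¹ E, which makes inverting the coordinate matrix
unnecessary. -/
theorem metric_inv_matrix (h : ∀ i j, ip g (e i) (e j) x = nullGram i j) :
    (g x)⁻¹ = (Matrix.of fun i => e i x).transpose * nullGramInv * (Matrix.of fun i => e i x) := by
  have hE := (frame_det h).1
  have h0 := frame_gram_matrix h
  set E := Matrix.of fun i => e i x with hEdef
  have hN : IsUnit nullGram.det :=
    (Matrix.isUnit_iff_isUnit_det _).1 (IsUnit.of_mul_eq_one _ nullGram_mul_inv)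
  refine Matrix.inv_eq_right_inv ?_
  have h1 : E * (g x * (E.transpose * nullGramInv * E)) = E * 1 := by
    calc E * (g x * (E.transpose * nullGramInv * E))
        = (E * g x * E.transpose) * nullGramInv * E := by simp only [Matrix.mul_assoc]
      _ = E * 1 := by rw [h0, nullGram_mul_inv, Matrix.one_mul, Matrix.mul_one]
  have h2 := congrArg (fun M => E⁻¹ * M) h1
  simpa only [← Matrix.mul_assoc, Matrix.nonsing_inv_mul _ hE, Matrix.one_mul] using h2

theorem metric_inv_apply (h : ∀ i j, ip g (e i) (e j) x = nullGram i j) (μ ν : Fin 4) :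
    (g x)⁻¹ μ ν = ∑ i, ∑ j, nullGramInv i j * e i x μ * e j x ν := by
  rw [metric_inv_matrix h]
  simp only [Matrix.mul_apply, Matrix.of_apply, Matrix.transpose_apply, Finset.sum_mul]
  rw [Finset.sum_comm]
  exact Finset.sum_congr rfl fun i _ => Finset.sum_congr rfl fun j _ => by ring

theorem eq_sum_raise (h : ∀ i j, ip g (e i) (e j) x = nullGram i j) (hs : ∀ y, (g y).IsSymm)
    {v : VF} {w : Fin 4 → ℝ} (hv : ∀ k, ip g v (e k) x = w k) :
    v x = ∑ k, raise w k • e k x := by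
  have hw : (Matrix.of fun i => e i x).mulVec ((g x).mulVec (v x)) = w := by
    ext k
    rw [← hv k, ip_symm hs]
    simp only [ip, Matrix.mulVec, dotProduct, Matrix.of_apply, Finset.mul_sum]
    exact Finset.sum_congr rfl fun i _ => Finset.sum_congr rfl fun j _ => by ring
  have h1 : (g x)⁻¹.mulVec ((g x).mulVec (v x)) = v x := by
    rw [Matrix.mulVec_mulVec, Matrix.nonsing_inv_mul _ (frame_det h).2, Matrix.one_mulVec]
  rw [← h1, metric_inv_matrix h, ← Matrix.mulVec_mulVec, hw, ← Matrix.mulVec_mulVec, ← raise_eq]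
  ext μ
  simp only [Matrix.mulVec, dotProduct, Matrix.of_apply, Matrix.transpose_apply, Finset.sum_apply,
    Pi.smul_apply, smul_eq_mul]
  exact Finset.sum_congr rfl fun i _ => by ring

theorem ip_sum_smul_left (c : Fin 4 → ℝ) (X : Fin 4 → VF) (Z : VF) {v : VF}
    (hv : v x = ∑ k, c k • X k x) : ip g v Z x = ∑ k, c k * ip g (X k) Z x := by
  simp only [ip, hv, Finset.sum_apply, Pi.smul_apply, smul_eq_mul, Finset.mul_sum, Finset.sum_mul]
  rw [Finset.sum_congr rfl fun μ _ => Finset.sum_comm, Finset.sum_comm]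
  exact Finset.sum_congr rfl fun k _ => Finset.sum_congr rfl fun μ _ =>
    Finset.sum_congr rfl fun ν _ => by ring

theorem ip_sum_raise (h : ∀ i j, ip g (e i) (e j) x = nullGram i j) {v : VF} {w : Fin 4 → ℝ}
    (hv : v x = ∑ k, raise w k • e k x) (l : Fin 4) : ip g v (e l) x = w l := by
  rw [ip_sum_smul_left _ _ _ hv]
  simp only [h, sum_raise_mul_nullGram]

/-- The connection coefficients of a null frame are determined by its commutators. -/
theorem ip_covD_frame (H : NullFrameAt g e x) {G : Fin 4 → Fin 4 → Fin 4 → ℝ}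
    (hG : ∀ i j k, G i j k = -G i k j)
    (hb : ∀ i j, bracket (e i) (e j) x = ∑ k, raise (fun l => G i j l - G j i l) k • e k x)
    (i j k : Fin 4) : ip g (covD g (e i) (e j)) (e k) x = G i j k := by
  have hgr := H.gram.self_of_nhds
  have hdet := (frame_det hgr).2
  refine koszul (G := fun i j k => ip g (covD g (e i) (e j)) (e k) x) (fun i j k => ?_) hG
    (fun i j k => ?_) i j k
  · have h1 := along_ip hdet H.symm H.diff_metric (e i) (e j) (e k) (H.diff_frame j)
      (H.diff_frame k)
    have h2 : along (e i) (ip g (e j) (e k)) x = 0 := by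
      rw [along_congr (h := fun _ => nullGram j k) (H.gram.mono fun y hy => hy j k), along_const]
    linarith
  · rw [← ip_sum_raise hgr (hb i j) k]
    simp only [ip, ← Finset.sum_sub_distrib]
    refine Finset.sum_congr rfl fun μ _ => Finset.sum_congr rfl fun ν _ => ?_
    rw [← covD_sub_covD H.symm]
    ring

theorem covD_frame (H : NullFrameAt g e x) {G : Fin 4 → Fin 4 → Fin 4 → ℝ}
    (hG : ∀ i j k, G i j k = -G i k j)
    (hb : ∀ i j, bracket (e i) (e j) x = ∑ k, raise (fun l => G i j l - G j i l) k • e k x)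
    (i j : Fin 4) : covD g (e i) (e j) x = ∑ k, raise (G i j) k • e k x :=
  eq_sum_raise H.gram.self_of_nhds H.symm (ip_covD_frame H hG hb i j)

theorem covD_congr {X Y Z : VF} (h : ∀ᶠ y in 𝓝 x, Y y = Z y) : covD g X Y x = covD g X Z x := by
  ext l
  simp only [covD, h.self_of_nhds]
  rw [along_congr (h := fun y => Z y l) (h.mono fun y hy => congrFun hy l)]

theorem covD_sum_left (c : Fin 4 → ℝ) (X : Fin 4 → VF) (Z : VF) {Y : VF}
    (hY : Y x = ∑ k, c k • X k x) : covD g Y Z x = ∑ k, c k • covD g (X k) Z x := by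
  ext l
  simp only [covD, Finset.sum_apply, Pi.smul_apply, smul_eq_mul, mul_add, Finset.sum_add_distrib]
  rw [along_sum_smul _ c X Y _ hY]
  congr 1
  simp only [hY, Finset.sum_apply, Pi.smul_apply, smul_eq_mul, Finset.mul_sum, Finset.sum_mul]
  rw [Finset.sum_congr rfl fun μ _ => Finset.sum_comm, Finset.sum_comm]
  exact Finset.sum_congr rfl fun k _ => Finset.sum_congr rfl fun μ _ =>
    Finset.sum_congr rfl fun ν _ => by ring

theorem covD_sum_right (c : Fin 4 → Pt → ℝ) (X : VF) (Z : Fin 4 → VF)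
    (hc : ∀ k, DifferentiableAt ℝ (c k) x) (hZ : ∀ k l, DifferentiableAt ℝ (fun y => Z k y l) x) :
    covD g X (fun y => ∑ k, c k y • Z k y) x =
      ∑ k, (along X (c k) x • Z k x + c k x • covD g X (Z k) x) := by
  ext l
  simp only [covD, Finset.sum_apply, Pi.smul_apply, Pi.add_apply, smul_eq_mul, mul_add,
    Finset.sum_add_distrib]
  rw [along_sum (f := fun k y => c k y * Z k y l) fun k _ => (hc k).mul (hZ k l)]
  simp only [along_mul (hc _) (hZ _ l), Finset.sum_add_distrib]
  rw [← add_assoc]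
  congr 1
  · rw [add_comm]
    congr 1
    exact Finset.sum_congr rfl fun k _ => by ring
  · simp only [Finset.mul_sum]
    rw [Finset.sum_congr rfl fun μ _ => Finset.sum_comm, Finset.sum_comm]
    exact Finset.sum_congr rfl fun k _ => Finset.sum_congr rfl fun μ _ =>
      Finset.sum_congr rfl fun ν _ => by ring

theorem raise_along {w : Fin 4 → Pt → ℝ} (hw : ∀ k, DifferentiableAt ℝ (w k) x) (X : VF)
    (k : Fin 4) : DifferentiableAt ℝ (fun y => raise (fun l => w l y) k) x ∧
      along X (fun y => raise (fun l => w l y) k) x = raise (fun l => along X (w l) x) k := by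
  have h (j : Fin 4) : along X (fun y => -(1 / 2) * w j y) x = -(1 / 2) * along X (w j) x := by
    rw [along_mul (f := fun _ => -(1 / 2 : ℝ)) (differentiableAt_const _) (hw j), along_const]
    ring
  fin_cases k
  · exact ⟨hw 0, rfl⟩
  · exact ⟨hw 1, rfl⟩
  · exact ⟨(hw 3).const_mul _, h 3⟩
  · exact ⟨(hw 2).const_mul _, h 2⟩

/-- The curvature in terms of the connection coefficients of a null frame. -/
theorem riem_frame (H : NullFrameAt g e x) {G : Fin 4 → Fin 4 → Fin 4 → Pt → ℝ}
    (hD : ∀ i j k, DifferentiableAt ℝ (G i j k) x)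
    (hc : ∀ᶠ y in 𝓝 x, ∀ i j, covD g (e i) (e j) y = ∑ k, raise (fun l => G i j l y) k • e k y)
    (hb : ∀ i j, bracket (e i) (e j) x =
      ∑ k, raise (fun l => G i j l x - G j i l x) k • e k x) (w z i j : Fin 4) :
    riem g (e w) (e z) (e i) (e j) x = along (e i) (G j z w) x - along (e j) (G i z w) x
      + ∑ k, raise (fun l => G j z l x) k * G i k w x
      - ∑ k, raise (fun l => G i z l x) k * G j k w x
      - ∑ k, raise (fun l => G i j l x - G j i l x) k * G k z w x := by
  have hgr := H.gram.self_of_nhds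
  have hip (v : VF) : ip g (e w) v x = ip g v (e w) x := ip_symm H.symm _ _
  have hip2 (i j k : Fin 4) : ip g (covD g (e i) (e j)) (e k) x = G i j k x :=
    ip_sum_raise hgr (hc.self_of_nhds i j) k
  have h2 (i j : Fin 4) : ip g (covD g (e i) (covD g (e j) (e z))) (e w) x =
      along (e i) (G j z w) x + ∑ k, raise (fun l => G j z l x) k * G i k w x := by
    have h3 : covD g (e i) (covD g (e j) (e z)) x =
        ∑ k, (raise (fun l => along (e i) (G j z l) x) k • e k x +
          raise (fun l => G j z l x) k • covD g (e i) (e k) x) := by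
      -- The inner covariant derivative gets differentiated again, so its frame expansion is needed
      -- on a neighbourhood and not only at the point.
      rw [covD_congr (Z := fun y => ∑ k, raise (fun l => G j z l y) k • e k y)
        (hc.mono fun y hy => hy j z), covD_sum_right (fun k y => raise (fun l => G j z l y) k)
        (e i) e (fun k => (raise_along (hD j z) (e i) k).1) H.diff_frame]
      simp only [(raise_along (hD j z) (e i) _).2]
    have h4 : ip g (covD g (e i) (covD g (e j) (e z))) (e w) x =
        ip g (fun y => ∑ k, raise (fun l => along (e i) (G j z l) x) k • e k y) (e w) x +
        ip g (fun y => ∑ k, raise (fun l => G j z l x) k • covD g (e i) (e k) y) (e w) x := by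
      rw [Finset.sum_add_distrib] at h3
      simp only [ip, h3, ← Finset.sum_add_distrib, Pi.add_apply]
      exact Finset.sum_congr rfl fun μ _ => Finset.sum_congr rfl fun ν _ => by ring
    rw [h4, ip_sum_raise hgr rfl, ip_sum_smul_left _ (fun k => covD g (e i) (e k)) _ rfl]
    simp only [hip2]
  have h5 : ip g (covD g (bracket (e i) (e j)) (e z)) (e w) x =
      ∑ k, raise (fun l => G i j l x - G j i l x) k * G k z w x := by
    rw [ip_sum_smul_left _ (fun k => covD g (e k) (e z)) _ (covD_sum_left _ e _ (hb i j))]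
    simp only [hip2]
  have h6 : riem g (e w) (e z) (e i) (e j) x =
      ip g (covD g (e i) (covD g (e j) (e z))) (e w) x
      - ip g (covD g (e j) (covD g (e i) (e z))) (e w) x
      - ip g (covD g (bracket (e i) (e j)) (e z)) (e w) x := by
    rw [riem, hip]
    simp only [ip, ← Finset.sum_sub_distrib]
    exact Finset.sum_congr rfl fun μ _ => Finset.sum_congr rfl fun ν _ => by ring
  rw [h6, h2, h2, h5]
  ring

end Frame

/-! ### Second derivatives and the wave operator in a null frame -/

section Second

variable {F : Type*} [NormedAddCommGroup F] [NormedSpace ℝ F] {f : Pt → F} {x : Pt}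

theorem differentiableAt_pd (hf : ContDiffAt ℝ 2 f x) (ν : Fin 4) :
    DifferentiableAt ℝ (pd ν f) x :=
  ((hf.fderiv_right (m := 1) (by norm_num)).differentiableAt (by norm_num)).clm_apply
    (differentiableAt_const _)

theorem pd_pd_comm (hf : ContDiffAt ℝ 2 f x) (μ ν : Fin 4) :
    pd μ (pd ν f) x = pd ν (pd μ f) x := by
  have hd := (hf.fderiv_right (m := 1) (by norm_num)).differentiableAt (by norm_num)
  have h (μ ν : Fin 4) : pd μ (pd ν f) x =
      fderiv ℝ (fderiv ℝ f) x (Pi.single μ 1) (Pi.single ν 1) := by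
    change fderiv ℝ (fun y => fderiv ℝ f y (Pi.single ν 1)) x (Pi.single μ 1) = _
    rw [fderiv_clm_apply hd (differentiableAt_const _)]
    simp
  rw [h, h]
  exact (hf.isSymmSndFDerivAt (by simp)) _ _

theorem pd_smul {μ : Fin 4} {c : Pt → ℝ} (hc : DifferentiableAt ℝ c x)
    (hf : DifferentiableAt ℝ f x) :
    pd μ (fun y => c y • f y) x = c x • pd μ f x + pd μ c x • f x := by
  simp [pd, fderiv_fun_smul hc hf]

theorem differentiableAt_along (hf : ContDiffAt ℝ 2 f x) {Y : VF}
    (hY : ∀ l, DifferentiableAt ℝ (fun y => Y y l) x) : DifferentiableAt ℝ (along Y f) x :=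
  DifferentiableAt.fun_sum fun ν _ => (hY ν).smul (differentiableAt_pd hf ν)

theorem along_along (hf : ContDiffAt ℝ 2 f x) (X : VF) {Y : VF}
    (hY : ∀ l, DifferentiableAt ℝ (fun y => Y y l) x) :
    along X (along Y f) x = (∑ μ, ∑ ν, (X x μ * Y x ν) • pd μ (pd ν f) x) +
      ∑ ν, along X (fun y => Y y ν) x • pd ν f x := by
  have h : ∀ μ, pd μ (along Y f) x =
      ∑ ν, (Y x ν • pd μ (pd ν f) x + pd μ (fun y => Y y ν) x • pd ν f x) := by
    intro μ
    change pd μ (fun y => ∑ ν, Y y ν • pd ν f y) x = _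
    rw [pd_sum (f := fun ν y => Y y ν • pd ν f y)
      fun ν _ => (hY ν).smul (differentiableAt_pd hf ν)]
    exact Finset.sum_congr rfl fun ν _ => pd_smul (hY ν) (differentiableAt_pd hf ν)
  rw [along]
  simp only [h, Finset.sum_add_distrib, smul_add, Finset.smul_sum, smul_smul]
  congr 1
  rw [Finset.sum_comm]
  refine Finset.sum_congr rfl fun ν _ => ?_
  rw [along, Finset.sum_smul]
  rfl

theorem along_comm (hf : ContDiffAt ℝ 2 f x) {X Y : VF}
    (hX : ∀ l, DifferentiableAt ℝ (fun y => X y l) x)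
    (hY : ∀ l, DifferentiableAt ℝ (fun y => Y y l) x) :
    along X (along Y f) x - along Y (along X f) x = along (bracket X Y) f x := by
  rw [along_along hf X hY, along_along hf Y hX]
  have : ∑ μ, ∑ ν, (Y x μ * X x ν) • pd μ (pd ν f) x =
      ∑ μ, ∑ ν, (X x μ * Y x ν) • pd μ (pd ν f) x := by
    rw [Finset.sum_comm]
    refine Finset.sum_congr rfl fun μ _ => Finset.sum_congr rfl fun ν _ => ?_
    rw [pd_pd_comm hf ν μ, mul_comm]
  rw [this]
  simp only [along, bracket, sub_smul, Finset.sum_sub_distrib]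
  abel

end Second

/-- The wave operator is the metric trace of the Hessian X(Y f) - (D_X Y) f. The Hessian is
tensorial, because the derivatives of the components of Y cancel between its two terms, so the trace
may be taken in the frame. -/
theorem box_frame {g : Metric} {e : Fin 4 → VF} {x : Pt} (H : NullFrameAt g e x) {f : Pt → ℂ}
    (hf : ContDiffAt ℝ 2 f x) :
    box g f x = ∑ i, ∑ j, (nullGramInv i j : ℂ) *
      (along (e i) (along (e j) f) x - along (covD g (e i) (e j)) f x) := by
  have h1 : ∀ i j, along (e i) (along (e j) f) x - along (covD g (e i) (e j)) f x =
      ∑ μ, ∑ ν, ((e i x μ * e j x ν : ℝ) : ℂ) * (pd μ (pd ν f) x -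
        ∑ l, (christoffel g l μ ν x : ℂ) * pd l f x) := by
    intro i j
    rw [along_along hf _ (H.diff_frame j)]
    have h2 : along (covD g (e i) (e j)) f x = (∑ l, along (e i) (fun y => e j y l) x • pd l f x) +
        ∑ μ, ∑ ν, ((e i x μ * e j x ν : ℝ) : ℂ) * ∑ l, (christoffel g l μ ν x : ℂ) * pd l f x := by
      rw [along]
      simp only [covD, add_smul, Finset.sum_add_distrib]
      congr 1
      simp only [Finset.sum_smul, Finset.mul_sum]
      rw [Finset.sum_comm]
      refine Finset.sum_congr rfl fun μ _ => ?_
      rw [Finset.sum_comm]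
      refine Finset.sum_congr rfl fun ν _ => Finset.sum_congr rfl fun l _ => ?_
      rw [Complex.real_smul]
      push_cast
      ring
    rw [h2]
    simp only [mul_sub, Finset.sum_sub_distrib, Complex.real_smul]
    ring
  simp only [h1, box]
  simp only [metric_inv_apply H.gram.self_of_nhds]
  push_cast
  simp only [Finset.mul_sum (s := Finset.univ (α := Fin 4)) (f := fun μ => ∑ ν, _),
    Finset.sum_mul]
  have hc (T : Fin 4 → Fin 4 → Fin 4 → Fin 4 → ℂ) :
      ∑ μ, ∑ ν, ∑ i, ∑ j, T μ ν i j = ∑ i, ∑ j, ∑ μ, ∑ ν, T μ ν i j := by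
    rw [Finset.sum_congr rfl fun μ _ => Finset.sum_comm, Finset.sum_comm]
    refine Finset.sum_congr rfl fun i _ => ?_
    rw [Finset.sum_congr rfl fun μ _ => Finset.sum_comm, Finset.sum_comm]
  rw [hc]
  refine Finset.sum_congr rfl fun i _ => Finset.sum_congr rfl fun j _ => ?_
  simp only [Finset.mul_sum]
  refine Finset.sum_congr rfl fun μ _ => Finset.sum_congr rfl fun ν _ => ?_
  change _ * (pd μ (pd ν f) x - _) = _
  ring

/-! ### Reduction of the tensorial Teukolsky operator to a scalar operator -/

/-- The basis `e^1 - i e^2` of the anti-self dual horizontal 1-forms. -/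
def asdForm : Fin 2 → ℂ := ![1, -Complex.I]

/-- The basis `(e^1 - i e^2) ⊗ (e^1 - i e^2)` of the anti-self dual symmetric traceless
horizontal 2-tensors. -/
def asdTensor : Fin 2 → Fin 2 → ℂ := ![![1, -Complex.I], ![-Complex.I, -1]]

/-- A real symmetric traceless u has two free entries, and they combine into the single complex
number u_11 + i u_12, which is the first component of U. -/
theorem IsAntiSelfDual.eq_smul {U : Fin 2 → Fin 2 → ℂ} (h : IsAntiSelfDual U) (a b : Fin 2) :
    U a b = U 0 0 * asdTensor a b := by
  obtain ⟨u, hs, ht, hU⟩ := h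
  rw [Fin.sum_univ_two] at ht
  have h0 : (u 1 1 : ℂ) = -u 0 0 := by
    rw [← Complex.ofReal_neg]
    exact congrArg _ (by linarith)
  have h1 : u 1 0 = u 0 1 := hs 1 0
  rw [hU a b, hU 0 0]
  fin_cases a <;> fin_cases b <;> simp [asdTensor, eps, Fin.sum_univ_two, h0, h1]
  · linear_combination (u 0 1 : ℂ) * Complex.I_sq
  · linear_combination (u 0 1 : ℂ) * Complex.I_sq
  · ring

section Scalar

variable (g : Metric) (e : Fin 4 → VF)

/-- `⁽ᶜ⁾∇_3` on the scalar component of an anti-self dual tensor of conformal type `2`. -/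
def scalar3 (f : Pt → ℂ) (x : Pt) : ℂ :=
  along (e 2) f x + (2 * Complex.I * (hconn g e (e 2) 0 1 x : ℂ) - 4 * (omb g e x : ℂ)) * f x

/-- `⁽ᶜ⁾∇_4` on the scalar component of an anti-self dual tensor of conformal type `2`. -/
def scalar4 (f : Pt → ℂ) (x : Pt) : ℂ :=
  along (e 3) f x + (2 * Complex.I * (hconn g e (e 3) 0 1 x : ℂ) + 4 * (om g e x : ℂ)) * f x

/-- `⁽ᶜ⁾∇_b` on the scalar component of an anti-self dual tensor of conformal type `2`. -/
def scalarH (b : Fin 2) (f : Pt → ℂ) (x : Pt) : ℂ :=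
  along (e (hz b)) f x +
    (2 * Complex.I * (hconn g e (e (hz b)) 0 1 x : ℂ) + 2 * (zeta g e b x : ℂ)) * f x

/-- `⁽ᶜ⁾𝒟̄ ·` on the scalar component of an anti-self dual tensor of conformal type `2`. -/
def scalarDiv (f : Pt → ℂ) (x : Pt) : ℂ :=
  2 * (scalarH g e 0 f x - Complex.I * scalarH g e 1 f x)

/-- The Teukolsky operator on the scalar component of an anti-self dual tensor. -/
def teukolskyScalar (f : Pt → ℂ) (x : Pt) : ℂ :=
  -(along (e 3) (scalar3 g e f) x +
      (2 * Complex.I * (hconn g e (e 3) 0 1 x : ℂ) + 2 * (om g e x : ℂ)) * scalar3 g e f x)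
  + (1 / 2) * ((along (e 0) (scalarDiv g e f) x +
        (Complex.I * (hconn g e (e 0) 0 1 x : ℂ) + 2 * (zeta g e 0 x : ℂ)) * scalarDiv g e f x)
      + Complex.I * (along (e 1) (scalarDiv g e f) x +
        (Complex.I * (hconn g e (e 1) 0 1 x : ℂ) + 2 * (zeta g e 1 x : ℂ)) * scalarDiv g e f x))
  + (-(1 / 2) * trX g e x - 2 * (starRingEnd ℂ) (trX g e x)) * scalar3 g e f x
  - (1 / 2) * trXb g e x * scalar4 g e f x
  + 4 * bigH g e x 0 * (scalarH g e 0 f x - Complex.I * scalarH g e 1 f x)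
  + 2 * ((etab g e 0 x : ℂ) * scalarH g e 0 f x + (etab g e 1 x : ℂ) * scalarH g e 1 f x)
  + (-((starRingEnd ℂ) (trX g e x)) * trXb g e x + 2 * (starRingEnd ℂ) (curvP g e x)) * f x
  + 4 * bigH g e x 0 * (starRingEnd ℂ) (bigHb g e x 0) * f x

variable {g e}

theorem along_mul_const {X : VF} {f : Pt → ℂ} {x : Pt} (hf : DifferentiableAt ℝ f x) (c : ℂ) :
    along X (fun y => f y * c) x = along X f x * c := by
  rw [along_mul hf (differentiableAt_const c), along_const]
  ring

/-- The horizontal connection takes values in so(2), and e^1 - i e^2 is an eigenvector of rotations.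
Each factor of it contributes i times the rotation coefficient: once here, twice in `nabla2_asd`. -/
theorem nabla1_asd {X : VF} {φ : HForm} {f : Pt → ℂ} {x : Pt} (hf : DifferentiableAt ℝ f x)
    (hφ : ∀ᶠ y in 𝓝 x, ∀ a, φ y a = f y * asdForm a)
    (hX : ∀ a b, hconn g e X a b x = -hconn g e X b a x) (a : Fin 2) :
    nabla1 g e X φ x a =
      (along X f x + Complex.I * (hconn g e X 0 1 x : ℂ) * f x) * asdForm a := by
  have h0 := hX 0 0
  have h1 := hX 1 1
  rw [nabla1, along_congr (h := fun y => f y * asdForm a) (hφ.mono fun y hy => hy a),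
    along_mul_const hf]
  simp only [hφ.self_of_nhds, Fin.sum_univ_two]
  fin_cases a
  · simp [asdForm, show hconn g e X 0 0 x = 0 by linarith]
    ring
  · simp [asdForm, show hconn g e X 1 1 x = 0 by linarith, hX 1 0]
    linear_combination (hconn g e X 0 1 x * f x : ℂ) * Complex.I_sq

theorem nabla2_asd {X : VF} {A : HTensor} {f : Pt → ℂ} {x : Pt} (hf : DifferentiableAt ℝ f x)
    (hA : ∀ᶠ y in 𝓝 x, ∀ a b, A y a b = f y * asdTensor a b)
    (hX : ∀ a b, hconn g e X a b x = -hconn g e X b a x) (a b : Fin 2) :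
    nabla2 g e X A x a b =
      (along X f x + 2 * Complex.I * (hconn g e X 0 1 x : ℂ) * f x) * asdTensor a b := by
  have h0 := hX 0 0
  have h1 := hX 1 1
  rw [nabla2, along_congr (h := fun y => f y * asdTensor a b) (hA.mono fun y hy => hy a b),
    along_mul_const hf]
  simp only [hA.self_of_nhds, Fin.sum_univ_two]
  have h0' : hconn g e X 0 0 x = 0 := by linarith
  have h1' : hconn g e X 1 1 x = 0 := by linarith
  have h2 : hconn g e X 1 0 x = -hconn g e X 0 1 x := hX 1 0
  fin_cases a <;> fin_cases b
  · simp [asdTensor, h0']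
    ring
  · simp [asdTensor, h0', h1', h2]
    linear_combination (2 * hconn g e X 0 1 x * f x : ℂ) * Complex.I_sq
  · simp [asdTensor, h0', h1', h2]
    linear_combination (2 * hconn g e X 0 1 x * f x : ℂ) * Complex.I_sq
  · simp [asdTensor, h1', h2]
    ring

/-- Each building block sends multiples of `asdTensor` or `asdForm` to multiples of one of them.
This holds for any frame whose horizontal connection is skew near the point; nothing specific to
Kerr enters. -/
theorem teukolskyOp_asd {A : HTensor} {f : Pt → ℂ} {x : Pt} (hf : ∀ᶠ y in 𝓝 x, DifferentiableAt ℝ f y)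
    (h3 : DifferentiableAt ℝ (scalar3 g e f) x) (hdiv : DifferentiableAt ℝ (scalarDiv g e f) x)
    (hA : ∀ᶠ y in 𝓝 x, ∀ a b, A y a b = f y * asdTensor a b)
    (hh : ∀ᶠ y in 𝓝 x, ∀ i a b, hconn g e (e i) a b y = -hconn g e (e i) b a y) (a b : Fin 2) :
    teukolskyOp g e A x a b = teukolskyScalar g e f x * asdTensor a b := by
  have e3 : ∀ᶠ y in 𝓝 x, ∀ a b, cNabla3 g e 2 A y a b = scalar3 g e f y * asdTensor a b := by
    filter_upwards [hf, eventually_eventually_nhds.2 hA, hh] with y hy1 hy2 hy3 a b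
    rw [cNabla3, nabla2_asd hy1 hy2 (hy3 2), hy2.self_of_nhds, scalar3]
    push_cast
    ring
  have eH : ∀ᶠ y in 𝓝 x, ∀ c a b, cNablaH2 g e 2 c A y a b = scalarH g e c f y * asdTensor a b := by
    filter_upwards [hf, eventually_eventually_nhds.2 hA, hh] with y hy1 hy2 hy3 c a b
    rw [cNablaH2, nabla2_asd hy1 hy2 (hy3 (hz c)), hy2.self_of_nhds, scalarH]
    push_cast
    ring
  -- Both values of the contracted index give the same contribution, whence the factor 2 in
  -- `scalarDiv`.
  have eD : ∀ᶠ y in 𝓝 x, ∀ a, cDbarDiv g e 2 A y a = scalarDiv g e f y * asdForm a := by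
    filter_upwards [eH] with y hy a
    simp only [cDbarDiv, hy, scalarDiv, Fin.sum_univ_two]
    fin_cases a
    · simp [eps, asdTensor, asdForm]
      linear_combination -(scalarH g e 0 f y) * Complex.I_sq
    · simp [eps, asdTensor, asdForm]
      linear_combination -(scalarH g e 1 f y) * Complex.I_sq
  have e4 : cNabla4 g e 2 A x a b = scalar4 g e f x * asdTensor a b := by
    rw [cNabla4, nabla2_asd hf.self_of_nhds hA (hh.self_of_nhds 3), hA.self_of_nhds, scalar4]
    push_cast
    ring
  have e43 : cNabla4 g e 1 (cNabla3 g e 2 A) x a b = (along (e 3) (scalar3 g e f) x +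
      (2 * Complex.I * (hconn g e (e 3) 0 1 x : ℂ) + 2 * (om g e x : ℂ)) * scalar3 g e f x)
        * asdTensor a b := by
    rw [cNabla4, nabla2_asd h3 e3 (hh.self_of_nhds 3), e3.self_of_nhds]
    push_cast
    ring
  have eD1 : ∀ c a, cNablaH1 g e 2 c (cDbarDiv g e 2 A) x a =
      (along (e (hz c)) (scalarDiv g e f) x + (Complex.I * (hconn g e (e (hz c)) 0 1 x : ℂ) +
        2 * (zeta g e c x : ℂ)) * scalarDiv g e f x) * asdForm a := by
    intro c a
    rw [cNablaH1, nabla1_asd hdiv eD (hh.self_of_nhds (hz c)), eD.self_of_nhds]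
    push_cast
    ring
  have eHat : cDHat g e 2 (cDbarDiv g e 2 A) x a b =
      ((along (e 0) (scalarDiv g e f) x +
        (Complex.I * (hconn g e (e 0) 0 1 x : ℂ) + 2 * (zeta g e 0 x : ℂ)) * scalarDiv g e f x)
      + Complex.I * (along (e 1) (scalarDiv g e f) x +
        (Complex.I * (hconn g e (e 1) 0 1 x : ℂ) + 2 * (zeta g e 1 x : ℂ)) * scalarDiv g e f x))
        * asdTensor a b := by
    -- Only proportionality to `asdForm` matters for the symmetrised traceless product, so the two
    -- coefficients are abstracted to w; the result is (w_1 + i w_2) times the basis tensor.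
    obtain ⟨w, hw⟩ : ∃ w : Fin 2 → ℂ, w = fun c => along (e (hz c)) (scalarDiv g e f) x +
      (Complex.I * (hconn g e (e (hz c)) 0 1 x : ℂ) +
        2 * (zeta g e c x : ℂ)) * scalarDiv g e f x := ⟨_, rfl⟩
    have k : ∀ c a, cNablaH1 g e 2 c (cDbarDiv g e 2 A) x a = w c * asdForm a := by
      rw [hw]
      exact eD1
    change _ = ((fun c => along (e (hz c)) (scalarDiv g e f) x +
      (Complex.I * (hconn g e (e (hz c)) 0 1 x : ℂ) +
        2 * (zeta g e c x : ℂ)) * scalarDiv g e f x) 0 + Complex.I * (fun c =>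
      along (e (hz c)) (scalarDiv g e f) x + (Complex.I * (hconn g e (e (hz c)) 0 1 x : ℂ) +
        2 * (zeta g e c x : ℂ)) * scalarDiv g e f x) 1) * _
    rw [← hw]
    simp only [cDHat, cD1, Fin.sum_univ_two, k]
    clear * -
    fin_cases a <;> fin_cases b <;> simp [eps, asdTensor, asdForm] <;> ring_nf <;>
      simp only [Complex.I_sq] <;> ring
  have eQ : HHbU g e A x a b =
      4 * bigH g e x 0 * (starRingEnd ℂ) (bigHb g e x 0) * f x * asdTensor a b := by
    -- H and H̲ are anti-self dual by construction, so each is determined by its first component.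
    have k0 : bigH g e x 1 = -Complex.I * bigH g e x 0 := by
      simp [bigH, eps, Fin.sum_univ_two]
      linear_combination (eta g e 1 x : ℂ) * Complex.I_sq
    have k1 : (starRingEnd ℂ) (bigHb g e x 1) = Complex.I * (starRingEnd ℂ) (bigHb g e x 0) := by
      simp [bigHb, eps, Fin.sum_univ_two]
      linear_combination (etab g e 1 x : ℂ) * Complex.I_sq
    simp only [HHbU, hA.self_of_nhds, Fin.sum_univ_two, k0, k1]
    clear * - k0
    fin_cases a <;> fin_cases b <;> simp [asdTensor, k0] <;> ring_nf <;>
      simp only [Complex.I_sq, Complex.I_pow_three] <;> ring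
  -- H̲ plus its conjugate is 2η̲, while contracting with H produces only the combination ∇_1 -
  -- i∇_2.
  have eG : ∑ c, (4 * bigH g e x c + bigHb g e x c + (starRingEnd ℂ) (bigHb g e x c))
      * cNablaH2 g e 2 c A x a b =
      (4 * bigH g e x 0 * (scalarH g e 0 f x - Complex.I * scalarH g e 1 f x)
      + 2 * ((etab g e 0 x : ℂ) * scalarH g e 0 f x + (etab g e 1 x : ℂ) * scalarH g e 1 f x))
        * asdTensor a b := by
    simp only [Fin.sum_univ_two, eH.self_of_nhds]
    simp [bigH, bigHb, eps, Fin.sum_univ_two]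
    ring_nf
    simp only [Complex.I_sq]
    ring
  simp only [teukolskyOp, e43, eHat, e3.self_of_nhds, e4, eG, eQ, hA.self_of_nhds, teukolskyScalar]
  ring

end Scalar

/-! ### Functions of `r` and `θ` -/

section Grad

variable {F : Type*} [NormedAddCommGroup F] [NormedSpace ℝ F]

/-- `f` is differentiable at `x` with `∂_r f = u`, `∂_θ f = v` and `∂_t f = ∂_φ f = 0`. -/
def HasGrad (f : Pt → F) (u v : F) (x : Pt) : Prop :=
  HasFDerivAt f ((ContinuousLinearMap.proj (R := ℝ) (φ := fun _ : Fin 4 => ℝ) 1).smulRight u +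
    (ContinuousLinearMap.proj (R := ℝ) (φ := fun _ : Fin 4 => ℝ) 2).smulRight v) x

variable {f h : Pt → F} {u v u' v' : F} {x : Pt}

theorem HasGrad.differentiableAt (H : HasGrad f u v x) : DifferentiableAt ℝ f x :=
  HasFDerivAt.differentiableAt H

theorem HasGrad.pd (H : HasGrad f u v x) (μ : Fin 4) : pd μ f x = ![0, u, v, 0] μ := by
  rw [KerrTeukolsky.pd, HasFDerivAt.fderiv H]
  fin_cases μ <;> simp

theorem HasGrad.along (H : HasGrad f u v x) (X : VF) : along X f x = X x 1 • u + X x 2 • v := by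
  simp [KerrTeukolsky.along, H.pd, Fin.sum_univ_four]

theorem HasGrad.congr (H : HasGrad f u v x) (hu : u = u') (hv : v = v') : HasGrad f u' v' x :=
  hu ▸ hv ▸ H

theorem HasGrad.congr_fun (H : HasGrad f u v x) (hf : ∀ y, h y = f y) : HasGrad h u v x := by
  rwa [show h = f from funext hf]

theorem hasGrad_const (c : F) (x : Pt) : HasGrad (fun _ => c) 0 0 x := by
  refine (hasFDerivAt_const c x).congr_fderiv ?_
  ext; simp

theorem HasGrad.add (H : HasGrad f u v x) (H' : HasGrad h u' v' x) :
    HasGrad (fun y => f y + h y) (u + u') (v + v') x := by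
  refine (HasFDerivAt.fun_add H H').congr_fderiv ?_
  ext i; simp; abel

theorem HasGrad.neg (H : HasGrad f u v x) : HasGrad (fun y => -f y) (-u) (-v) x := by
  refine (HasFDerivAt.fun_neg H).congr_fderiv ?_
  ext i; simp; abel

theorem HasGrad.sub (H : HasGrad f u v x) (H' : HasGrad h u' v' x) :
    HasGrad (fun y => f y - h y) (u - u') (v - v') x := by
  refine (HasFDerivAt.fun_sub H H').congr_fderiv ?_
  ext i; simp [smul_sub]; abel

theorem HasGrad.mul {𝕜 : Type*} [NormedField 𝕜] [NormedAlgebra ℝ 𝕜] {f h : Pt → 𝕜}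
    {u v u' v' : 𝕜} (H : HasGrad f u v x) (H' : HasGrad h u' v' x) :
    HasGrad (fun y => f y * h y) (u * h x + f x * u') (v * h x + f x * v') x := by
  refine (HasFDerivAt.fun_mul H H').congr_fderiv ?_
  ext i
  simp [Algebra.smul_def]
  ring

theorem HasGrad.inv {𝕜 : Type*} [NormedField 𝕜] [NormedAlgebra ℝ 𝕜] {f : Pt → 𝕜}
    {u v : 𝕜} (H : HasGrad f u v x) (hf : f x ≠ 0) :
    HasGrad (fun y => (f y)⁻¹) (-u / f x ^ 2) (-v / f x ^ 2) x := by
  refine ((hasFDerivAt_inv' hf).comp x H).congr_fderiv ?_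
  ext i
  simp [Algebra.smul_def]
  ring

theorem HasGrad.div {𝕜 : Type*} [NormedField 𝕜] [NormedAlgebra ℝ 𝕜] {f h : Pt → 𝕜}
    {u v u' v' : 𝕜} (H : HasGrad f u v x) (H' : HasGrad h u' v' x) (hh : h x ≠ 0) :
    HasGrad (fun y => f y / h y) ((u * h x - f x * u') / h x ^ 2)
      ((v * h x - f x * v') / h x ^ 2) x := by
  refine ((H.mul (H'.inv hh)).congr_fun fun y => div_eq_mul_inv _ _).congr ?_ ?_ <;>
  · field_simp
    ring

theorem HasGrad.ofReal {f : Pt → ℝ} {u v : ℝ} (H : HasGrad f u v x) :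
    HasGrad (fun y => (f y : ℂ)) (u : ℂ) (v : ℂ) x := by
  refine (Complex.ofRealCLM.hasFDerivAt.comp x H).congr_fderiv ?_
  ext i
  simp

theorem hasGrad_r (x : Pt) : HasGrad (fun y => y 1) 1 0 x := by
  refine (hasFDerivAt_apply (𝕜 := ℝ) 1 x).congr_fderiv ?_
  ext i
  simp

theorem hasGrad_theta (x : Pt) : HasGrad (fun y => y 2) 0 1 x := by
  refine (hasFDerivAt_apply (𝕜 := ℝ) 2 x).congr_fderiv ?_
  ext i
  simp

theorem HasGrad.comp {f : Pt → ℝ} {u v φ' : ℝ} {φ : ℝ → ℝ} (H : HasGrad f u v x)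
    (hφ : HasDerivAt φ φ' (f x)) : HasGrad (fun y => φ (f y)) (φ' * u) (φ' * v) x := by
  refine (hφ.comp_hasFDerivAt x H).congr_fderiv ?_
  ext i
  simp
  ring

theorem hasGrad_cos (x : Pt) : HasGrad (fun y => Real.cos (y 2)) 0 (-Real.sin (x 2)) x :=
  ((hasGrad_theta x).comp (Real.hasDerivAt_cos _)).congr (by simp) (by simp)

theorem hasGrad_sin (x : Pt) : HasGrad (fun y => Real.sin (y 2)) 0 (Real.cos (x 2)) x :=
  ((hasGrad_theta x).comp (Real.hasDerivAt_sin _)).congr (by simp) (by simp)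

end Grad

/-! ### The Kerr metric in the principal frame -/

section Kerr

variable {m a : ℝ} {x : Pt}

theorem qSq_pos (hx : x ∈ patch m a) : 0 < qSq a x := by
  have := hx.1
  unfold qSq
  positivity

theorem qAbs_pos (hx : x ∈ patch m a) : 0 < qAbs a x := Real.sqrt_pos.2 (qSq_pos hx)

theorem qAbs_sq (hx : x ∈ patch m a) : qAbs a x ^ 2 = qSq a x := Real.sq_sqrt (qSq_pos hx).le

theorem sin_pos_of_mem (hx : x ∈ patch m a) : 0 < Real.sin (x 2) :=
  Real.sin_pos_of_pos_of_lt_pi hx.2.2.1 hx.2.2.2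

theorem Del_ne_zero (hx : x ∈ patch m a) : Del m a x ≠ 0 := hx.2.1

theorem SigSq_pos (hm : 0 ≤ m) (hx : x ∈ patch m a) : 0 < SigSq m a x := by
  have := hx.1
  have := qSq_pos hx
  unfold SigSq
  positivity

theorem hasGrad_qSq (x : Pt) : HasGrad (fun y => qSq a y) (2 * x 1)
    (-2 * a ^ 2 * Real.cos (x 2) * Real.sin (x 2)) x := by
  refine ((((hasGrad_r x).mul (hasGrad_r x)).add ((hasGrad_const (a ^ 2) x).mul
    ((hasGrad_cos x).mul (hasGrad_cos x)))).congr_fun fun y => ?_).congr ?_ ?_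
  · simp only [qSq]
    ring
  · ring
  · ring

theorem hasGrad_Del (x : Pt) : HasGrad (fun y => Del m a y) (2 * x 1 - 2 * m) 0 x := by
  refine (((((hasGrad_r x).mul (hasGrad_r x)).sub ((hasGrad_const (2 * m) x).mul
    (hasGrad_r x))).add (hasGrad_const (a ^ 2) x)).congr_fun fun y => ?_).congr ?_ ?_
  · simp only [Del]
    ring
  · ring
  · ring

theorem hasGrad_qAbs (hx : x ∈ patch m a) : HasGrad (fun y => qAbs a y) (x 1 / qAbs a x)
    (-a ^ 2 * Real.cos (x 2) * Real.sin (x 2) / qAbs a x) x := by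
  have h := (hasGrad_qSq (a := a) x).comp (Real.hasDerivAt_sqrt (qSq_pos hx).ne')
  have := qAbs_pos hx
  refine h.congr ?_ ?_ <;>
  · change 1 / (2 * qAbs a x) * _ = _
    field_simp

theorem hasGrad_inv_qAbs (hx : x ∈ patch m a) : HasGrad (fun y => (qAbs a y)⁻¹)
    (-x 1 / qAbs a x ^ 3) (a ^ 2 * Real.cos (x 2) * Real.sin (x 2) / qAbs a x ^ 3) x := by
  have := qAbs_pos hx
  refine ((hasGrad_qAbs hx).inv this.ne').congr ?_ ?_ <;> field_simp

theorem hasGrad_inv_qSq (hx : x ∈ patch m a) : HasGrad (fun y => (qSq a y)⁻¹)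
    (-2 * x 1 / qSq a x ^ 2) (2 * a ^ 2 * Real.cos (x 2) * Real.sin (x 2) / qSq a x ^ 2) x := by
  refine ((hasGrad_qSq x).inv (qSq_pos hx).ne').congr ?_ ?_ <;> ring

theorem hasGrad_inv_Del (hx : x ∈ patch m a) : HasGrad (fun y => (Del m a y)⁻¹)
    (-(2 * x 1 - 2 * m) / Del m a x ^ 2) 0 x := by
  refine ((hasGrad_Del x).inv (Del_ne_zero hx)).congr ?_ ?_ <;> ring

theorem hasGrad_inv_sin (hx : x ∈ patch m a) : HasGrad (fun y => (Real.sin (y 2))⁻¹)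
    0 (-Real.cos (x 2) / Real.sin (x 2) ^ 2) x := by
  refine ((hasGrad_sin x).inv (sin_pos_of_mem hx).ne').congr ?_ ?_ <;> ring

theorem hasGrad_radius (x : Pt) : HasGrad (fun y => y 1 ^ 2 + a ^ 2) (2 * x 1) 0 x := by
  refine ((((hasGrad_r x).mul (hasGrad_r x)).add (hasGrad_const (a ^ 2) x)).congr_fun
    fun y => ?_).congr ?_ ?_ <;> ring

/-- The `r`-derivatives of the components of the principal frame. -/
def frameDr (m a : ℝ) (x : Pt) : Fin 4 → Fin 4 → ℝ :=
  ![![0, 0, -x 1 / qAbs a x ^ 3, 0],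
    ![-a * Real.sin (x 2) * x 1 / qAbs a x ^ 3, 0, 0,
      -x 1 / (qAbs a x ^ 3 * Real.sin (x 2))],
    ![2 * x 1 / qSq a x - 2 * x 1 * (x 1 ^ 2 + a ^ 2) / qSq a x ^ 2,
      -(2 * x 1 - 2 * m) / qSq a x + 2 * x 1 * Del m a x / qSq a x ^ 2, 0,
      -2 * a * x 1 / qSq a x ^ 2],
    ![2 * x 1 / Del m a x - (x 1 ^ 2 + a ^ 2) * (2 * x 1 - 2 * m) / Del m a x ^ 2, 0, 0,
      -a * (2 * x 1 - 2 * m) / Del m a x ^ 2]]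

/-- The `θ`-derivatives of the components of the principal frame. -/
def frameDtheta (m a : ℝ) (x : Pt) : Fin 4 → Fin 4 → ℝ :=
  let c := Real.cos (x 2)
  let s := Real.sin (x 2)
  ![![0, 0, a ^ 2 * c * s / qAbs a x ^ 3, 0],
    ![a * c / qAbs a x + a ^ 3 * c * s ^ 2 / qAbs a x ^ 3, 0, 0,
      a ^ 2 * c / qAbs a x ^ 3 - c / (qAbs a x * s ^ 2)],
    ![2 * (x 1 ^ 2 + a ^ 2) * a ^ 2 * c * s / qSq a x ^ 2,
      -2 * Del m a x * a ^ 2 * c * s / qSq a x ^ 2, 0, 2 * a ^ 3 * c * s / qSq a x ^ 2],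
    ![0, 0, 0, 0]]

theorem hasGrad_frame (hx : x ∈ patch m a) (j l : Fin 4) :
    HasGrad (fun y => frame m a j y l) (frameDr m a x j l) (frameDtheta m a x j l) x := by
  have hS := (qSq_pos hx).ne'
  have hQ := (qAbs_pos hx).ne'
  have hs := (sin_pos_of_mem hx).ne'
  have hD := Del_ne_zero hx
  have h0 := hasGrad_const (0 : ℝ) x
  have iQ := hasGrad_inv_qAbs hx
  have iS := hasGrad_inv_qSq hx
  have iD := hasGrad_inv_Del hx
  have ca := hasGrad_const a x
  have rr := hasGrad_radius (a := a) x
  fin_cases j <;> fin_cases l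
  · exact h0
  · exact h0
  · exact iQ.congr_fun fun y => one_div _
  · exact h0
  · refine ((ca.mul ((hasGrad_sin x).mul iQ)).congr_fun fun y => ?_).congr ?_ ?_
    · simp [frame]; ring
    · simp [frameDr]; field_simp
    · simp [frameDtheta]; field_simp
  · exact h0
  · exact h0
  · refine ((iQ.mul (hasGrad_inv_sin hx)).congr_fun fun y => ?_).congr ?_ ?_
    · simp [frame]; ring
    · simp [frameDr]; field_simp
    · simp [frameDtheta]; field_simp; ring
  · refine ((rr.mul iS).congr_fun fun y => ?_).congr ?_ ?_
    · simp [frame]; ring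
    · simp [frameDr]; field_simp; ring
    · simp [frameDtheta]; field_simp
  · refine (((hasGrad_Del (m := m) (a := a) x).mul iS).neg.congr_fun fun y => ?_).congr ?_ ?_
    · simp [frame]; ring
    · simp [frameDr]; field_simp; ring
    · simp [frameDtheta]; field_simp
  · exact h0
  · refine ((ca.mul iS).congr_fun fun y => ?_).congr ?_ ?_
    · simp [frame]; ring
    · simp [frameDr]; field_simp
    · simp [frameDtheta]; field_simp
  · refine ((rr.mul iD).congr_fun fun y => ?_).congr ?_ ?_
    · simp [frame]; ring
    · simp [frameDr]; field_simp; ring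
    · simp [frameDtheta]
  · exact hasGrad_const 1 x
  · exact h0
  · refine ((ca.mul iD).congr_fun fun y => ?_).congr ?_ ?_
    · simp [frame]; ring
    · simp [frameDr]; field_simp; ring
    · simp [frameDtheta]

end Kerr

/-! ### The principal frame is a null frame for the Kerr metric. -/

section Kerr

variable {m a : ℝ} {x : Pt}

theorem isOpen_patch (m a : ℝ) : IsOpen (patch m a) := by
  have h1 : Continuous fun x : Pt => x 1 := continuous_apply 1
  have h2 : Continuous fun x : Pt => x 2 := continuous_apply 2
  have hD : Continuous fun x : Pt => Del m a x := by unfold Del; fun_prop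
  exact (isOpen_lt continuous_const h1).inter ((isOpen_ne_fun hD continuous_const).inter
    ((isOpen_lt continuous_const h2).inter (isOpen_lt h2 continuous_const)))

theorem kerr_isSymm (m a : ℝ) (x : Pt) : (kerr m a x).IsSymm := by
  refine Matrix.IsSymm.ext fun i j => ?_
  fin_cases i <;> fin_cases j <;> simp [kerr]

theorem qSq_eq_sin (x : Pt) : qSq a x = x 1 ^ 2 + a ^ 2 - a ^ 2 * Real.sin (x 2) ^ 2 := by
  rw [qSq, Real.cos_sq']
  ring

/-- The components of the Kerr metric in terms of the Carter coframe. -/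
theorem ip_kerr (hm : 0 ≤ m) (hx : x ∈ patch m a) (X Y : VF) :
    ip (kerr m a) X Y x =
      -(Del m a x / qSq a x) * (X x 0 - a * Real.sin (x 2) ^ 2 * X x 3)
          * (Y x 0 - a * Real.sin (x 2) ^ 2 * Y x 3)
        + Real.sin (x 2) ^ 2 / qSq a x * ((x 1 ^ 2 + a ^ 2) * X x 3 - a * X x 0)
          * ((x 1 ^ 2 + a ^ 2) * Y x 3 - a * Y x 0)
        + qSq a x / Del m a x * X x 1 * Y x 1 + qSq a x * X x 2 * Y x 2 := by
  have hS := (qSq_pos hx).ne'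
  have hG := (SigSq_pos hm hx).ne'
  have hSs := qSq_eq_sin (a := a) x
  -- This second form of Σ² clears Σ² from the denominators of the (t, φ) block.
  have hGs : SigSq m a x = (x 1 ^ 2 + a ^ 2) ^ 2 - a ^ 2 * Real.sin (x 2) ^ 2 * Del m a x := by
    rw [SigSq, hSs, Del]
    ring
  have hDs : Del m a x = x 1 ^ 2 - 2 * m * x 1 + a ^ 2 := rfl
  have h00 : kerr m a x 0 0 = (-Del m a x + a ^ 2 * Real.sin (x 2) ^ 2) / qSq a x := by
    simp only [kerr, Matrix.of_apply, Matrix.cons_val]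
    field_simp
    rw [hGs, hSs, hDs]
    ring
  have h03 : kerr m a x 0 3 = (Del m a x - (x 1 ^ 2 + a ^ 2)) * a * Real.sin (x 2) ^ 2
      / qSq a x := by
    simp only [kerr, Matrix.of_apply, Matrix.cons_val]
    field_simp
    rw [hDs]
    ring
  have h33 : kerr m a x 3 3 = Real.sin (x 2) ^ 2 *
      ((x 1 ^ 2 + a ^ 2) ^ 2 - a ^ 2 * Real.sin (x 2) ^ 2 * Del m a x) / qSq a x := by
    simp only [kerr, Matrix.of_apply, Matrix.cons_val]
    rw [hGs]
    ring
  have h30 : kerr m a x 3 0 = kerr m a x 0 3 := (kerr_isSymm m a x).apply 0 3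
  have h11 : kerr m a x 1 1 = qSq a x / Del m a x := by simp [kerr]
  have h22 : kerr m a x 2 2 = qSq a x := by simp [kerr]
  have z1 : kerr m a x 0 1 = 0 ∧ kerr m a x 0 2 = 0 ∧ kerr m a x 1 0 = 0 ∧ kerr m a x 1 2 = 0 ∧
      kerr m a x 1 3 = 0 ∧ kerr m a x 2 0 = 0 ∧ kerr m a x 2 1 = 0 ∧ kerr m a x 2 3 = 0 ∧
      kerr m a x 3 1 = 0 ∧ kerr m a x 3 2 = 0 := by
    simp [kerr]
  obtain ⟨z1, z2, z3, z4, z5, z6, z7, z8, z9, z10⟩ := z1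
  simp only [ip, Fin.sum_univ_four, h30, h00, h03, h33, h11, h22, z1, z2, z3, z4, z5, z6, z7, z8,
    z9, z10]
  ring

/-- The Carter forms dt - a sin²θ dφ and (r² + a²) dφ - a dt are almost diagonal on the frame: the
first vanishes on e_1 and e_2, the second on e_1, e_3 and e_4. -/
theorem ip_frame (hm : 0 ≤ m) (hx : x ∈ patch m a) (i j : Fin 4) :
    ip (kerr m a) (frame m a i) (frame m a j) x = nullGram i j := by
  have hS := (qSq_pos hx).ne'
  have hQ := (qAbs_pos hx).ne'
  have hs := (sin_pos_of_mem hx).ne'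
  have hD := Del_ne_zero hx
  have hQ2 := qAbs_sq hx
  have hSs := qSq_eq_sin (a := a) x
  have t0 : frame m a 0 x 0 - a * Real.sin (x 2) ^ 2 * frame m a 0 x 3 = 0 := by simp [frame]
  have t1 : frame m a 1 x 0 - a * Real.sin (x 2) ^ 2 * frame m a 1 x 3 = 0 := by
    simp [frame]; field_simp
    ring
  have t2 : frame m a 2 x 0 - a * Real.sin (x 2) ^ 2 * frame m a 2 x 3 = 1 := by
    simp [frame]; field_simp; rw [hSs]
  have t3 : frame m a 3 x 0 - a * Real.sin (x 2) ^ 2 * frame m a 3 x 3 =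
      qSq a x / Del m a x := by
    simp [frame]; field_simp; rw [hSs]
  have s0 : (x 1 ^ 2 + a ^ 2) * frame m a 0 x 3 - a * frame m a 0 x 0 = 0 := by simp [frame]
  have s1 : (x 1 ^ 2 + a ^ 2) * frame m a 1 x 3 - a * frame m a 1 x 0 =
      qAbs a x / Real.sin (x 2) := by
    simp [frame]; field_simp; rw [hQ2, hSs]
  have s2 : (x 1 ^ 2 + a ^ 2) * frame m a 2 x 3 - a * frame m a 2 x 0 = 0 := by
    simp [frame]; ring
  have s3 : (x 1 ^ 2 + a ^ 2) * frame m a 3 x 3 - a * frame m a 3 x 0 = 0 := by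
    simp [frame]; ring
  rw [ip_kerr hm hx]
  fin_cases i <;> fin_cases j <;>
    simp only [Fin.mk_one, Fin.reduceFinMk, Fin.zero_eta, Fin.isValue, t0, t1, t2, t3, s0, s1, s2,
      s3] <;> simp [frame, nullGram] <;> field_simp <;> (try simp only [hQ2]) <;> ring

theorem differentiableAt_div {f h : Pt → ℝ} (hf : DifferentiableAt ℝ f x)
    (hh : DifferentiableAt ℝ h x) (h0 : h x ≠ 0) : DifferentiableAt ℝ (fun y => f y / h y) x := by
  simpa only [div_eq_mul_inv] using hf.fun_mul (hh.fun_inv h0)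

theorem differentiableAt_kerr (hm : 0 ≤ m) (hx : x ∈ patch m a) (μ ν : Fin 4) :
    DifferentiableAt ℝ (fun y => kerr m a y μ ν) x := by
  have hS := (qSq_pos hx).ne'
  have hG := (SigSq_pos hm hx).ne'
  have hD := Del_ne_zero hx
  have dr := (hasGrad_r x).differentiableAt
  have ds := (hasGrad_sin x).differentiableAt
  have dS := (hasGrad_qSq (a := a) x).differentiableAt
  have dD := (hasGrad_Del (m := m) (a := a) x).differentiableAt
  have dG : DifferentiableAt ℝ (fun y => SigSq m a y) x := by unfold SigSq; fun_prop
  have dk : DifferentiableAt ℝ (fun y => SigSq m a y * Real.sin (y 2) ^ 2 / qSq a y) x :=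
    differentiableAt_div (dG.mul (ds.pow 2)) dS hS
  have dw : DifferentiableAt ℝ (fun y => 2 * a * m * y 1 / SigSq m a y) x :=
    differentiableAt_div (dr.const_mul _) dG hG
  have dt : DifferentiableAt ℝ (fun y => -(qSq a y * Del m a y / SigSq m a y) +
      SigSq m a y * Real.sin (y 2) ^ 2 / qSq a y * (2 * a * m * y 1 / SigSq m a y) ^ 2) x :=
    (differentiableAt_div (dS.mul dD) dG hG).neg.add (dk.mul (dw.pow 2))
  have dR : DifferentiableAt ℝ (fun y => qSq a y / Del m a y) x := differentiableAt_div dS dD hD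
  have d0 := differentiableAt_const (𝕜 := ℝ) (E := Pt) (x := x) (0 : ℝ)
  fin_cases μ <;> fin_cases ν
  · exact dt
  · exact d0
  · exact d0
  · exact (dk.mul dw).neg
  · exact d0
  · exact dR
  · exact d0
  · exact d0
  · exact d0
  · exact d0
  · exact dS
  · exact d0
  · exact (dk.mul dw).neg
  · exact d0
  · exact d0
  · exact dk

theorem nullFrameAt_kerr (hm : 0 ≤ m) (hx : x ∈ patch m a) :
    NullFrameAt (kerr m a) (frame m a) x where
  symm := kerr_isSymm m a
  gram := ((isOpen_patch m a).mem_nhds hx |> Filter.eventually_of_mem) fun _ hy => ip_frame hm hy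
  diff_metric := differentiableAt_kerr hm hx
  diff_frame j l := (hasGrad_frame hx j l).differentiableAt

end Kerr

/-! ### The connection coefficients of the principal frame -/

section Kerr

variable (m a : ℝ)

/-- `r / |q|²` -/
def coefA (x : Pt) : ℝ := x 1 / qSq a x

/-- `a cos θ / |q|²` -/
def coefB (x : Pt) : ℝ := a * Real.cos (x 2) / qSq a x

/-- `Δ / |q|²` -/
def coefD (x : Pt) : ℝ := Del m a x / qSq a x

/-- `∂_r (Δ / |q|²) / 2` -/
def coefO (x : Pt) : ℝ := (x 1 - m) / qSq a x - x 1 * Del m a x / qSq a x ^ 2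

/-- `a² cos θ sin θ / |q|³` -/
def coefU (x : Pt) : ℝ := a ^ 2 * Real.cos (x 2) * Real.sin (x 2) / qAbs a x ^ 3

/-- `a r sin θ / |q|³` -/
def coefW (x : Pt) : ℝ := a * x 1 * Real.sin (x 2) / qAbs a x ^ 3

/-- `∂_r (∂_r (Δ / |q|²) / 2)` -/
def coefO_r (x : Pt) : ℝ :=
  1 / qSq a x - 4 * x 1 * (x 1 - m) / qSq a x ^ 2 - Del m a x / qSq a x ^ 2
      + 4 * x 1 ^ 2 * Del m a x / qSq a x ^ 3

/-- `∂_r (a cos θ / |q|²)` -/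
def coefB_r (x : Pt) : ℝ :=
  -2 * a * Real.cos (x 2) * x 1 / qSq a x ^ 2

/-- `∂_θ Λ` -/
def Lam_theta (x : Pt) : ℝ :=
  (x 1 ^ 2 + a ^ 2) * (-1 / (qAbs a x ^ 3 * Real.sin (x 2) ^ 2)
      + 3 * a ^ 2 * Real.cos (x 2) ^ 2 / qAbs a x ^ 5)

/-- `∂_θ (a² cos θ sin θ / |q|³)` -/
def coefU_theta (x : Pt) : ℝ :=
  a ^ 2 * (Real.cos (x 2) ^ 2 - Real.sin (x 2) ^ 2) / qAbs a x ^ 3 +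
      3 * a ^ 4 * Real.cos (x 2) ^ 2 * Real.sin (x 2) ^ 2 / qAbs a x ^ 5

/-- `∂_θ (a r sin θ / |q|³)` -/
def coefW_theta (x : Pt) : ℝ :=
  a * x 1 * Real.cos (x 2) / qAbs a x ^ 3 +
      3 * a ^ 3 * x 1 * Real.cos (x 2) * Real.sin (x 2) ^ 2 / qAbs a x ^ 5

/-- The skew-symmetric matrix with the given entries above the diagonal. -/
def skew (p q r s t u : ℝ) : Matrix (Fin 4) (Fin 4) ℝ :=
  !![0, p, q, r; -p, 0, s, t; -q, -s, 0, u; -r, -t, -u, 0]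

/-- The connection coefficients `g(D_i e_j, e_k)` of the principal frame. -/
def ricci (i : Fin 4) (x : Pt) : Matrix (Fin 4) (Fin 4) ℝ :=
  ![skew 0 (coefD m a x * coefA a x) (-coefA a x) (-(coefD m a x * coefB a x)) (-coefB a x)
      (-(2 * coefU a x)),
    skew (Lam a x) (coefD m a x * coefB a x) (coefB a x) (coefD m a x * coefA a x) (-coefA a x)
      (-(2 * coefW a x)),
    skew (coefD m a x * coefB a x) 0 (2 * coefU a x) 0 (-(2 * coefW a x)) (4 * coefO m a x),
    skew (coefB a x) (2 * coefU a x) 0 (2 * coefW a x) 0 0] i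

variable {m a} {x : Pt}

theorem skew_antisymm (p q r s t u : ℝ) (j k : Fin 4) :
    skew p q r s t u j k = -skew p q r s t u k j := by
  fin_cases j <;> fin_cases k <;> simp [skew]

theorem ricci_antisymm (i j k : Fin 4) : ricci m a i x j k = -ricci m a i x k j := by
  fin_cases i <;> exact skew_antisymm _ _ _ _ _ _ j k

theorem raise_neg (w : Fin 4 → ℝ) (k : Fin 4) : raise (fun l => -w l) k = -raise w k := by
  fin_cases k <;> simp [raise]

-- This componentwise check is what certifies the table `ricci`: being skew, the table is the
-- connection as soon as its antisymmetrisation reproduces the commutators.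
set_option maxHeartbeats 1600000 in
theorem bracket_frame_of_lt (hx : x ∈ patch m a) (i j : Fin 4) (hij : i < j) :
    bracket (frame m a i) (frame m a j) x =
      ∑ k, raise (fun l => ricci m a i x j l - ricci m a j x i l) k • frame m a k x := by
  have hS := (qSq_pos hx).ne'
  have hQ := (qAbs_pos hx).ne'
  have hs := (sin_pos_of_mem hx).ne'
  have hD := Del_ne_zero hx
  have hQ2 := qAbs_sq hx
  have hSs := qSq_eq_sin (a := a) x
  ext l
  simp only [bracket, (hasGrad_frame hx _ _).along, Finset.sum_apply, Pi.smul_apply,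
    Fin.sum_univ_four, smul_eq_mul]
  have hcot : Real.cot (x 2) = Real.cos (x 2) / Real.sin (x 2) := Real.cot_eq_cos_div_sin _
  fin_cases i <;> fin_cases j <;> first | exact absurd hij (by decide) | skip
  all_goals fin_cases l <;>
    simp [frame, frameDr, frameDtheta, ricci, skew, raise, coefA, coefB, coefD, coefO, coefU,
      coefW, Lam, hcot, ← hQ2] <;> field_simp <;>
    first | done | ring1 | (ring_nf; simp only [hQ2, hSs]; ring)

theorem bracket_frame (hx : x ∈ patch m a) (i j : Fin 4) :
    bracket (frame m a i) (frame m a j) x =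
      ∑ k, raise (fun l => ricci m a i x j l - ricci m a j x i l) k • frame m a k x := by
  rcases lt_trichotomy i j with h | rfl | h
  · exact bracket_frame_of_lt hx i j h
  · have : raise (fun l => ricci m a i x i l - ricci m a i x i l) = 0 := by
      ext k
      fin_cases k <;> simp [raise]
    rw [this]
    ext l
    simp [bracket]
  · have h1 : bracket (frame m a i) (frame m a j) x = -bracket (frame m a j) (frame m a i) x := by
      ext l
      simp [bracket]
    rw [h1, bracket_frame_of_lt hx j i h, ← Finset.sum_neg_distrib]
    refine Finset.sum_congr rfl fun k _ => ?_
    rw [← neg_smul, ← raise_neg]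
    simp only [neg_sub]

theorem ip_covD_kerr (hm : 0 ≤ m) (hx : x ∈ patch m a) (i j k : Fin 4) :
    ip (kerr m a) (covD (kerr m a) (frame m a i) (frame m a j)) (frame m a k) x =
      ricci m a i x j k :=
  ip_covD_frame (nullFrameAt_kerr hm hx) (G := fun i j k => ricci m a i x j k) ricci_antisymm
    (bracket_frame hx) i j k

theorem covD_kerr (hm : 0 ≤ m) (hx : x ∈ patch m a) (i j : Fin 4) :
    covD (kerr m a) (frame m a i) (frame m a j) x =
      ∑ k, raise (ricci m a i x j) k • frame m a k x :=
  covD_frame (nullFrameAt_kerr hm hx) (G := fun i j k => ricci m a i x j k) ricci_antisymm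
    (bracket_frame hx) i j

theorem hasGrad_coefA (hx : x ∈ patch m a) : HasGrad (coefA a)
    (1 / qSq a x - 2 * x 1 ^ 2 / qSq a x ^ 2)
    (2 * x 1 * a ^ 2 * Real.cos (x 2) * Real.sin (x 2) / qSq a x ^ 2) x := by
  have hS := (qSq_pos hx).ne'
  refine ((hasGrad_r x).div (hasGrad_qSq x) hS).congr ?_ ?_
  · field_simp
  · field_simp
    ring

theorem hasGrad_coefB (hx : x ∈ patch m a) : HasGrad (coefB a)
    (coefB_r a x)
    (-a * Real.sin (x 2) / qSq a x +
      2 * a ^ 3 * Real.cos (x 2) ^ 2 * Real.sin (x 2) / qSq a x ^ 2) x := by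
  have hS := (qSq_pos hx).ne'
  rw [coefB_r]
  refine (((hasGrad_const a x).mul (hasGrad_cos x)).div (hasGrad_qSq x) hS).congr ?_ ?_ <;>
    field_simp <;> ring

theorem hasGrad_coefD (hx : x ∈ patch m a) : HasGrad (coefD m a) (2 * coefO m a x)
    (2 * Del m a x * a ^ 2 * Real.cos (x 2) * Real.sin (x 2) / qSq a x ^ 2) x := by
  have hS := (qSq_pos hx).ne'
  refine ((hasGrad_Del x).div (hasGrad_qSq x) hS).congr ?_ ?_
  · rw [coefO]
    field_simp
  · field_simp
    ring

theorem hasGrad_coefO (hx : x ∈ patch m a) : HasGrad (coefO m a)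
    (coefO_r m a x)
    (2 * (x 1 - m) * a ^ 2 * Real.cos (x 2) * Real.sin (x 2) / qSq a x ^ 2
      - 4 * x 1 * Del m a x * a ^ 2 * Real.cos (x 2) * Real.sin (x 2) / qSq a x ^ 3) x := by
  have hS := (qSq_pos hx).ne'
  rw [coefO_r]
  refine (((((hasGrad_r x).sub (hasGrad_const m x)).div (hasGrad_qSq x) hS).sub
    ((((hasGrad_r x).mul (hasGrad_Del (m := m) (a := a) x)).mul (hasGrad_inv_qSq hx)).mul
      (hasGrad_inv_qSq hx))).congr_fun fun y => ?_).congr ?_ ?_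
  · rw [coefO]
    ring
  · field_simp
    ring
  · field_simp
    ring

theorem hasGrad_inv_qAbs_cube (hx : x ∈ patch m a) : HasGrad (fun y => (qAbs a y ^ 3)⁻¹)
    (-3 * x 1 / qAbs a x ^ 5)
    (3 * a ^ 2 * Real.cos (x 2) * Real.sin (x 2) / qAbs a x ^ 5) x := by
  have hQ := (qAbs_pos hx).ne'
  have h := hasGrad_inv_qAbs hx
  refine ((h.mul (h.mul h)).congr_fun fun y => ?_).congr ?_ ?_
  · ring
  · field_simp
    ring
  · field_simp
    ring

theorem hasGrad_coefU (hx : x ∈ patch m a) : HasGrad (coefU a)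
    (-3 * x 1 * a ^ 2 * Real.cos (x 2) * Real.sin (x 2) / qAbs a x ^ 5)
    (coefU_theta a x) x := by
  have hQ := (qAbs_pos hx).ne'
  rw [coefU_theta]
  refine ((((hasGrad_const (a ^ 2) x).mul ((hasGrad_cos x).mul (hasGrad_sin x))).mul
    (hasGrad_inv_qAbs_cube hx)).congr_fun fun y => ?_).congr ?_ ?_
  · rw [coefU]
    ring
  · field_simp
    ring
  · field_simp
    ring

theorem hasGrad_coefW (hx : x ∈ patch m a) : HasGrad (coefW a)
    (a * Real.sin (x 2) / qAbs a x ^ 3 - 3 * a * x 1 ^ 2 * Real.sin (x 2) / qAbs a x ^ 5)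
    (coefW_theta a x) x := by
  have hQ := (qAbs_pos hx).ne'
  rw [coefW_theta]
  refine ((((hasGrad_const a x).mul ((hasGrad_r x).mul (hasGrad_sin x))).mul
    (hasGrad_inv_qAbs_cube hx)).congr_fun fun y => ?_).congr ?_ ?_
  · rw [coefW]
    ring
  · field_simp
    ring
  · field_simp
    ring

theorem Lam_eq (y : Pt) : Lam a y =
    (y 1 ^ 2 + a ^ 2) * ((qAbs a y ^ 3)⁻¹ * (Real.cos (y 2) * (Real.sin (y 2))⁻¹)) := by
  rw [Lam, Real.cot_eq_cos_div_sin]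
  ring

theorem hasGrad_Lam (hx : x ∈ patch m a) : HasGrad (Lam a)
    (2 * x 1 * Real.cos (x 2) / (qAbs a x ^ 3 * Real.sin (x 2))
      - 3 * x 1 * (x 1 ^ 2 + a ^ 2) * Real.cos (x 2) / (qAbs a x ^ 5 * Real.sin (x 2)))
    (Lam_theta a x) x := by
  have hQ := (qAbs_pos hx).ne'
  have hs := (sin_pos_of_mem hx).ne'
  rw [Lam_theta]
  refine (((hasGrad_radius x).mul ((hasGrad_inv_qAbs_cube hx).mul
    ((hasGrad_cos x).mul (hasGrad_inv_sin hx)))).congr_fun Lam_eq).congr ?_ ?_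
  · field_simp
    ring
  · field_simp
    linear_combination (-qAbs a x ^ 2 * (x 1 ^ 2 + a ^ 2)) * Real.sin_sq_add_cos_sq (x 2)

theorem differentiableAt_ricci (hx : x ∈ patch m a) (i j k : Fin 4) :
    DifferentiableAt ℝ (fun y => ricci m a i y j k) x := by
  have dA := (hasGrad_coefA hx).differentiableAt
  have dB := (hasGrad_coefB hx).differentiableAt
  have dD := (hasGrad_coefD hx).differentiableAt
  have dO := (hasGrad_coefO hx).differentiableAt
  have dU := (hasGrad_coefU hx).differentiableAt
  have dW := (hasGrad_coefW hx).differentiableAt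
  have dL := (hasGrad_Lam hx).differentiableAt
  fin_cases i <;> fin_cases j <;> fin_cases k <;> simp [ricci, skew] <;> fun_prop

end Kerr

/-! ### Ricci and curvature components of the principal frame -/

section Kerr

variable {m a : ℝ} {x : Pt}

theorem trChi_kerr (hm : 0 ≤ m) (hx : x ∈ patch m a) :
    trChi (kerr m a) (frame m a) x = 2 * coefA a x := by
  simp [trChi, chi, Fin.sum_univ_two, ip_covD_kerr hm hx, ricci, skew, hz]
  ring

theorem atrChi_kerr (hm : 0 ≤ m) (hx : x ∈ patch m a) :
    atrChi (kerr m a) (frame m a) x = 2 * coefB a x := by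
  simp [atrChi, chi, Fin.sum_univ_two, ip_covD_kerr hm hx, ricci, skew, hz, eps]
  ring

theorem trChib_kerr (hm : 0 ≤ m) (hx : x ∈ patch m a) :
    trChib (kerr m a) (frame m a) x = -2 * coefD m a x * coefA a x := by
  simp [trChib, chib, Fin.sum_univ_two, ip_covD_kerr hm hx, ricci, skew, hz]
  ring

theorem atrChib_kerr (hm : 0 ≤ m) (hx : x ∈ patch m a) :
    atrChib (kerr m a) (frame m a) x = 2 * coefD m a x * coefB a x := by
  simp [atrChib, chib, Fin.sum_univ_two, ip_covD_kerr hm hx, ricci, skew, hz, eps]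
  ring

theorem eta_kerr (hm : 0 ≤ m) (hx : x ∈ patch m a) (b : Fin 2) :
    eta (kerr m a) (frame m a) b x = ![-coefU a x, coefW a x] b := by
  fin_cases b <;> simp [eta, ip_covD_kerr hm hx, ricci, skew, hz]

theorem etab_kerr (hm : 0 ≤ m) (hx : x ∈ patch m a) (b : Fin 2) :
    etab (kerr m a) (frame m a) b x = ![-coefU a x, -coefW a x] b := by
  fin_cases b <;> simp [etab, ip_covD_kerr hm hx, ricci, skew, hz]

theorem zeta_kerr (hm : 0 ≤ m) (hx : x ∈ patch m a) (b : Fin 2) :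
    zeta (kerr m a) (frame m a) b x = ![coefU a x, coefW a x] b := by
  fin_cases b <;> simp [zeta, ip_covD_kerr hm hx, ricci, skew, hz]

theorem om_kerr (hm : 0 ≤ m) (hx : x ∈ patch m a) : om (kerr m a) (frame m a) x = 0 := by
  simp [om, ip_covD_kerr hm hx, ricci, skew]

theorem omb_kerr (hm : 0 ≤ m) (hx : x ∈ patch m a) :
    omb (kerr m a) (frame m a) x = coefO m a x := by
  simp [omb, ip_covD_kerr hm hx, ricci, skew]

theorem hconn_kerr_antisymm (hm : 0 ≤ m) (hx : x ∈ patch m a) (i : Fin 4) (b c : Fin 2) :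
    hconn (kerr m a) (frame m a) (frame m a i) b c x =
      -hconn (kerr m a) (frame m a) (frame m a i) c b x := by
  simp only [hconn, ip_covD_kerr hm hx]
  exact ricci_antisymm _ _ _

theorem hconn_kerr (hm : 0 ≤ m) (hx : x ∈ patch m a) (i : Fin 4) :
    hconn (kerr m a) (frame m a) (frame m a i) 0 1 x =
      ![0, Lam a x, coefD m a x * coefB a x, coefB a x] i := by
  simp only [hconn, ip_covD_kerr hm hx]
  fin_cases i <;> simp [ricci, skew, hz]

theorem eventually_patch (hx : x ∈ patch m a) : ∀ᶠ y in 𝓝 x, y ∈ patch m a :=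
  (isOpen_patch m a).mem_nhds hx

theorem riem_kerr (hm : 0 ≤ m) (hx : x ∈ patch m a) (w z i j : Fin 4) :
    riem (kerr m a) (frame m a w) (frame m a z) (frame m a i) (frame m a j) x =
      along (frame m a i) (fun y => ricci m a j y z w) x
      - along (frame m a j) (fun y => ricci m a i y z w) x
      + ∑ k, raise (ricci m a j x z) k * ricci m a i x k w
      - ∑ k, raise (ricci m a i x z) k * ricci m a j x k w
      - ∑ k, raise (fun l => ricci m a i x j l - ricci m a j x i l) k * ricci m a k x z w :=
  riem_frame (nullFrameAt_kerr hm hx) (G := fun i j k y => ricci m a i y j k)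
    (differentiableAt_ricci hx) ((eventually_patch hx).mono fun _ hy => covD_kerr hm hy)
    (bracket_frame hx) w z i j

/-- The even powers of `|q|` and of `sin θ` as polynomials in `r` and `cos θ`. -/
theorem even_powers (hx : x ∈ patch m a) :
    qAbs a x ^ 2 = x 1 ^ 2 + a ^ 2 * Real.cos (x 2) ^ 2 ∧
    qAbs a x ^ 4 = (x 1 ^ 2 + a ^ 2 * Real.cos (x 2) ^ 2) ^ 2 ∧
    Real.sin (x 2) ^ 2 = 1 - Real.cos (x 2) ^ 2 ∧
    Real.sin (x 2) ^ 4 = (1 - Real.cos (x 2) ^ 2) ^ 2 := by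
  have h : qAbs a x ^ 2 = x 1 ^ 2 + a ^ 2 * Real.cos (x 2) ^ 2 := qAbs_sq hx
  refine ⟨h, ?_, Real.sin_sq _, ?_⟩
  · rw [← h]; ring
  · rw [← Real.sin_sq]; ring

/-- Together with `rhoDual_kerr` this says P = -2m/q³. The only derivative term is e_4 applied to
g(D_3 e_3, e_4) = 4ω̲, because ω = 0 in this frame. -/
theorem rho_kerr (hm : 0 ≤ m) (hx : x ∈ patch m a) : rho (kerr m a) (frame m a) x =
    -2 * m * x 1 * (x 1 ^ 2 - 3 * a ^ 2 * Real.cos (x 2) ^ 2) / qSq a x ^ 3 := by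
  have hS := (qSq_pos hx).ne'
  have hQ := (qAbs_pos hx).ne'
  have hQ2 := qAbs_sq hx
  have h1 : along (frame m a 3) (fun y => ricci m a 2 y 2 3) x = 4 *
      (coefO_r m a x) := by
    have : HasGrad (fun y => ricci m a 2 y 2 3) _ _ x := (hasGrad_const 4 x).mul (hasGrad_coefO hx)
    rw [this.along]
    simp [frame]
  have h2 : along (frame m a 2) (fun y => ricci m a 3 y 2 3) x = 0 := along_const _ 0 x
  rw [rho, riem_kerr hm hx, h1, h2]
  simp [Fin.sum_univ_four, ricci, skew, raise, coefU, coefW, coefO, coefO_r]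
  have hD : Del m a x = x 1 ^ 2 - 2 * m * x 1 + a ^ 2 := rfl
  obtain ⟨p2, p4, s2, s4⟩ := even_powers hx
  simp only [← hQ2, hD]
  field_simp
  ring_nf
  simp only [p2, p4, s2]
  ring

theorem rhoDual_kerr (hm : 0 ≤ m) (hx : x ∈ patch m a) : rhoDual (kerr m a) (frame m a) x =
    2 * m * a * Real.cos (x 2) * (3 * x 1 ^ 2 - a ^ 2 * Real.cos (x 2) ^ 2) / qSq a x ^ 3 := by
  have hS := (qSq_pos hx).ne'
  have hQ := (qAbs_pos hx).ne'
  have hQ2 := qAbs_sq hx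
  have h1 : along (frame m a 2) (fun y => ricci m a 3 y 1 0) x =
      Del m a x / qSq a x * coefB_r a x := by
    have : HasGrad (fun y => ricci m a 3 y 1 0) _ _ x := (hasGrad_coefB hx).neg
    rw [this.along]
    simp [frame]
  have h2 : along (frame m a 3) (fun y => ricci m a 2 y 1 0) x =
      -(2 * coefO m a x * coefB a x + coefD m a x *
        (coefB_r a x)) := by
    have : HasGrad (fun y => ricci m a 2 y 1 0) _ _ x :=
      ((hasGrad_coefD hx).mul (hasGrad_coefB hx)).neg
    rw [this.along]
    simp [frame]
  rw [rhoDual, riem_kerr hm hx, h1, h2]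
  simp [Fin.sum_univ_four, ricci, skew, raise, coefU, coefW, coefO, coefA, coefB, coefD, Lam_eq,
    coefB_r]
  have hs := (sin_pos_of_mem hx).ne'
  have hD : Del m a x = x 1 ^ 2 - 2 * m * x 1 + a ^ 2 := rfl
  obtain ⟨p2, p4, s2, s4⟩ := even_powers hx
  simp only [← hQ2, hD]
  field_simp
  ring_nf
  simp only [p2, s2]
  ring

/-- The real part of the identity satisfied by the potential. -/
theorem potential_identity_re (hm : 0 ≤ m) (hx : x ∈ patch m a) :
    4 * (coefO_r m a x)
    + 2 * (Lam_theta a x) / qAbs a x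
    - 6 * coefD m a x * coefB a x ^ 2 + 2 * coefD m a x * coefA a x ^ 2
    - 6 * rho (kerr m a) (frame m a) x + 2 * Lam a x ^ 2 + 4 * coefU a x ^ 2
    - 12 * coefW a x ^ 2 = 0 := by
  have hS := (qSq_pos hx).ne'
  have hQ := (qAbs_pos hx).ne'
  have hs := (sin_pos_of_mem hx).ne'
  have hQ2 := qAbs_sq hx
  have hD : Del m a x = x 1 ^ 2 - 2 * m * x 1 + a ^ 2 := rfl
  obtain ⟨p2, p4, s2, s4⟩ := even_powers hx
  rw [rho_kerr hm hx]
  simp only [coefA, coefB, coefD, coefU, coefW, Lam_eq, coefO_r, Lam_theta, ← hQ2, hD]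
  field_simp
  ring_nf
  simp only [p2, p4, s2, s4]
  ring

/-- The imaginary part of the identity satisfied by the potential. -/
theorem potential_identity_im (hm : 0 ≤ m) (hx : x ∈ patch m a) :
    2 * coefO m a x * coefB a x + coefD m a x * (coefB_r a x)
    + (coefW_theta a x) / qAbs a x
    + coefW a x * Lam a x - rhoDual (kerr m a) (frame m a) x = 0 := by
  have hS := (qSq_pos hx).ne'
  have hQ := (qAbs_pos hx).ne'
  have hs := (sin_pos_of_mem hx).ne'
  have hQ2 := qAbs_sq hx
  have hD : Del m a x = x 1 ^ 2 - 2 * m * x 1 + a ^ 2 := rfl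
  obtain ⟨p2, p4, s2, s4⟩ := even_powers hx
  rw [rhoDual_kerr hm hx]
  simp only [coefO, coefB, coefD, coefW, Lam_eq, coefB_r, coefW_theta, ← hQ2, hD]
  field_simp
  ring_nf
  simp only [p2, s2]
  ring

end Kerr

/-! ### The wave equation for the scalar component -/

section Kerr

variable {m a : ℝ} {x : Pt} {f : Pt → ℂ}

/-- `e_i e_j f - e_j e_i f` in the principal frame. -/
theorem along_comm_kerr (hx : x ∈ patch m a) (hf : ContDiffAt ℝ 2 f x) (i j : Fin 4) :
    along (frame m a i) (along (frame m a j) f) x - along (frame m a j) (along (frame m a i) f) x =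
      ∑ k, (raise (fun l => ricci m a i x j l - ricci m a j x i l) k : ℂ)
        * along (frame m a k) f x := by
  have hd (i l : Fin 4) := (hasGrad_frame hx i l).differentiableAt
  rw [along_comm hf (hd i) (hd j), along_sum_smul _ _ _ _ _ (bracket_frame hx i j)]
  simp only [Complex.real_smul]

/-- The Teukolsky operator contains the ordered products (e_1 + i e_2)(e_1 - i e_2) and e_4 e_3, so
only this commutator and that of (e_3, e_4) enter the comparison with the wave operator. The e_3 and
e_4 terms here measure the non-integrability of the horizontal distribution. -/
theorem along_comm_kerr_12 (hx : x ∈ patch m a) (hf : ContDiffAt ℝ 2 f x) :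
    along (frame m a 0) (along (frame m a 1) f) x - along (frame m a 1) (along (frame m a 0) f) x =
      -(Lam a x : ℂ) * along (frame m a 1) f x + (coefB a x : ℂ) * along (frame m a 2) f x
        + (coefD m a x : ℂ) * (coefB a x : ℂ) * along (frame m a 3) f x := by
  rw [along_comm_kerr hx hf]
  simp [Fin.sum_univ_four, raise, ricci, skew]
  ring

theorem along_comm_kerr_34 (hx : x ∈ patch m a) (hf : ContDiffAt ℝ 2 f x) :
    along (frame m a 2) (along (frame m a 3) f) x - along (frame m a 3) (along (frame m a 2) f) x =
      4 * (coefW a x : ℂ) * along (frame m a 1) f x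
        + 2 * (coefO m a x : ℂ) * along (frame m a 3) f x := by
  rw [along_comm_kerr hx hf]
  simp [Fin.sum_univ_four, raise, ricci, skew]
  ring

/-- The wave operator in the principal frame. -/
theorem box_kerr (hm : 0 ≤ m) (hx : x ∈ patch m a) (hf : ContDiffAt ℝ 2 f x) :
    box (kerr m a) f x =
      along (frame m a 0) (along (frame m a 0) f) x + along (frame m a 1) (along (frame m a 1) f) x
      - (1 / 2) * (along (frame m a 2) (along (frame m a 3) f) x +
        along (frame m a 3) (along (frame m a 2) f) x)
      + ((Lam a x : ℂ) - 2 * (coefU a x : ℂ)) * along (frame m a 0) f x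
      - (coefA a x : ℂ) * along (frame m a 2) f x
      + ((coefD m a x : ℂ) * (coefA a x : ℂ) + (coefO m a x : ℂ)) * along (frame m a 3) f x := by
  have h (i j : Fin 4) : along (covD (kerr m a) (frame m a i) (frame m a j)) f x =
      ∑ k, (raise (ricci m a i x j) k : ℂ) * along (frame m a k) f x := by
    rw [along_sum_smul _ _ _ _ _ (covD_kerr hm hx i j)]
    simp only [Complex.real_smul]
  rw [box_frame (nullFrameAt_kerr hm hx) hf]
  simp only [h]
  simp [Fin.sum_univ_four, raise, ricci, skew, nullGramInv]
  ring

/-- The zeroth order coefficient of `⁽ᶜ⁾∇_3` on the scalar component. -/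
def coefThree (m a : ℝ) (x : Pt) : ℂ :=
  2 * Complex.I * ((coefD m a x * coefB a x : ℝ) : ℂ) - 4 * (coefO m a x : ℂ)

/-- The zeroth order coefficient of the divergence on the scalar component. -/
def coefDiv (a : ℝ) (x : Pt) : ℂ :=
  2 * (coefU a x : ℂ) + 2 * (Lam a x : ℂ) - 2 * Complex.I * (coefW a x : ℂ)

theorem scalar3_kerr (hm : 0 ≤ m) (hx : x ∈ patch m a) :
    scalar3 (kerr m a) (frame m a) f x =
      along (frame m a 2) f x + coefThree m a x * f x := by
  simp [scalar3, hconn_kerr hm hx, omb_kerr hm hx, coefThree]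

theorem scalarH_kerr (hm : 0 ≤ m) (hx : x ∈ patch m a) (b : Fin 2) :
    scalarH (kerr m a) (frame m a) b f x = along (frame m a (hz b)) f x +
      ![2 * (coefU a x : ℂ), 2 * Complex.I * (Lam a x : ℂ) + 2 * (coefW a x : ℂ)] b * f x := by
  fin_cases b <;> simp [scalarH, hconn_kerr hm hx, zeta_kerr hm hx, hz]

theorem scalarDiv_kerr (hm : 0 ≤ m) (hx : x ∈ patch m a) :
    scalarDiv (kerr m a) (frame m a) f x = 2 * (along (frame m a 0) f x +
      -Complex.I * along (frame m a 1) f x + coefDiv a x * f x) := by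
  simp [scalarDiv, scalarH_kerr hm hx, coefDiv, hz]
  linear_combination (-2 * (Lam a x : ℂ) * f x) * Complex.I_sq

theorem differentiableAt_along_frame (hx : x ∈ patch m a) (hf : ContDiffAt ℝ 2 f x) (i : Fin 4) :
    DifferentiableAt ℝ (along (frame m a i) f) x :=
  differentiableAt_along hf fun l => (hasGrad_frame hx i l).differentiableAt

/-- The θ-derivative may stay unspecified: this function is only differentiated along e_4, which has
no ∂_θ component. -/
theorem hasGrad_coefThree (hx : x ∈ patch m a) : ∃ v, HasGrad (coefThree m a)
    (2 * Complex.I * ((2 * coefO m a x * coefB a x + coefD m a x *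
      (coefB_r a x) : ℝ) : ℂ) -
      4 * (coefO_r m a x : ℂ)) v x :=
  ⟨_, (((hasGrad_const (2 * Complex.I) x).mul
    ((hasGrad_coefD hx).mul (hasGrad_coefB hx)).ofReal).sub ((hasGrad_const 4 x).mul
      (hasGrad_coefO hx).ofReal)).congr (by ring) rfl⟩

/-- The r-derivative may stay unspecified: this function is only differentiated along e_1 and e_2,
which have no ∂_r component. -/
theorem hasGrad_coefDiv (hx : x ∈ patch m a) : ∃ u, HasGrad (coefDiv a) u
    (2 * (coefU_theta a x : ℂ) +
      2 * (Lam_theta a x : ℂ) -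
      2 * Complex.I * (coefW_theta a x : ℂ)) x :=
  ⟨_, ((((hasGrad_const 2 x).mul (hasGrad_coefU hx).ofReal).add ((hasGrad_const 2 x).mul
    (hasGrad_Lam hx).ofReal)).sub ((hasGrad_const (2 * Complex.I) x).mul
      (hasGrad_coefW hx).ofReal)).congr rfl (by ring)⟩

theorem along_etab_kerr (hm : 0 ≤ m) (hx : x ∈ patch m a) :
    along (frame m a 0) (etab (kerr m a) (frame m a) 0) x = -(coefU_theta a x / qAbs a x) := by
  rw [along_congr (h := fun y => -coefU a y)
    ((eventually_patch hx).mono fun y hy => etab_kerr hm hy 0), (hasGrad_coefU hx).neg.along]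
  simp [frame]
  ring

theorem differentiableAt_scalar3 (hm : 0 ≤ m) (hx : x ∈ patch m a) (hf : ContDiffAt ℝ 2 f x) :
    DifferentiableAt ℝ (scalar3 (kerr m a) (frame m a) f) x := by
  obtain ⟨v, g⟩ := hasGrad_coefThree hx
  exact ((differentiableAt_along_frame hx hf 2).fun_add (g.differentiableAt.fun_mul
    (hf.differentiableAt (by norm_num)))).congr_of_eventuallyEq
    ((eventually_patch hx).mono fun y hy => scalar3_kerr hm hy)

theorem differentiableAt_scalarDiv (hm : 0 ≤ m) (hx : x ∈ patch m a) (hf : ContDiffAt ℝ 2 f x) :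
    DifferentiableAt ℝ (scalarDiv (kerr m a) (frame m a) f) x := by
  obtain ⟨u, g⟩ := hasGrad_coefDiv hx
  have hdi := differentiableAt_along_frame hx hf
  exact ((((hdi 0).fun_add ((hdi 1).const_mul _)).fun_add (g.differentiableAt.fun_mul
    (hf.differentiableAt (by norm_num)))).const_mul 2).congr_of_eventuallyEq
    ((eventually_patch hx).mono fun y hy => scalarDiv_kerr hm hy)

/-- Once everything is expressed through the frame derivatives of f and the functions in `ricci`,
the two sides differ by commutator terms and by a zeroth order term, which the two potential
identities remove. -/
theorem teukolskyScalar_kerr (hm : 0 ≤ m) (hx : x ∈ patch m a) (hf : ContDiffAt ℝ 2 f x) :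
    teukolskyScalar (kerr m a) (frame m a) f x = box (kerr m a) f x - waveRHS m a f x := by
  have hd := hf.differentiableAt (by norm_num)
  have hdi := differentiableAt_along_frame hx hf
  obtain ⟨v3, g3⟩ := hasGrad_coefThree hx
  obtain ⟨uD, gD⟩ := hasGrad_coefDiv hx
  have e3 : along (frame m a 3) (scalar3 (kerr m a) (frame m a) f) x =
      along (frame m a 3) (along (frame m a 2) f) x +
      (coefThree m a x * along (frame m a 3) f x + f x * along (frame m a 3) (coefThree m a) x) := by
    rw [along_congr (h := fun y => along (frame m a 2) f y + coefThree m a y * f y)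
      ((eventually_patch hx).mono fun y hy => scalar3_kerr hm hy),
      along_add (hdi 2) (g3.differentiableAt.fun_mul hd), along_mul g3.differentiableAt hd]
  have eD (i : Fin 4) : along (frame m a i) (scalarDiv (kerr m a) (frame m a) f) x =
      2 * (along (frame m a i) (along (frame m a 0) f) x +
      -Complex.I * along (frame m a i) (along (frame m a 1) f) x +
      (coefDiv a x * along (frame m a i) f x + f x * along (frame m a i) (coefDiv a) x)) := by
    rw [along_congr (h := fun y => 2 * (along (frame m a 0) f y +
      -Complex.I * along (frame m a 1) f y + coefDiv a y * f y))
      ((eventually_patch hx).mono fun y hy => scalarDiv_kerr hm hy)]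
    have d1 := (differentiableAt_const (𝕜 := ℝ) (x := x) (-Complex.I)).fun_mul (hdi 1)
    have d2 := gD.differentiableAt.fun_mul hd
    rw [along_mul (differentiableAt_const _) (((hdi 0).fun_add d1).fun_add d2),
      along_add ((hdi 0).fun_add d1) d2, along_add (hdi 0) d1,
      along_mul (differentiableAt_const _) (hdi 1), along_mul gD.differentiableAt hd,
      along_const, along_const]
    ring
  have eU := along_etab_kerr hm hx
  have t3 : along (frame m a 3) (coefThree m a) x = 2 * Complex.I * ((2 * coefO m a x * coefB a x + coefD m a x *
      (coefB_r a x) : ℝ) : ℂ) -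
      4 * (coefO_r m a x : ℂ) := by
    rw [g3.along]
    simp [frame]
  have tD : along (frame m a 0) (coefDiv a) x = ((1 / qAbs a x : ℝ) : ℂ) * (2 * (coefU_theta a x : ℂ) +
      2 * (Lam_theta a x : ℂ) -
      2 * Complex.I * (coefW_theta a x : ℂ)) := by
    rw [gD.along]
    simp [frame]
  have tD1 : along (frame m a 1) (coefDiv a) x = 0 := by
    rw [gD.along]
    simp [frame]
  have c12 := along_comm_kerr_12 hx hf
  have c34 := along_comm_kerr_34 hx hf
  have Vre := congrArg (fun t : ℝ => (t : ℂ)) (potential_identity_re hm hx)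
  have Vim := congrArg (fun t : ℝ => (t : ℂ)) (potential_identity_im hm hx)
  rw [box_kerr hm hx hf]
  simp only [teukolskyScalar, waveRHS, potV, potRe, potIm, e3, eD, eU, t3, tD, tD1, trX, trXb,
    curvP, bigH, bigHb, trChi_kerr hm hx, atrChi_kerr hm hx, trChib_kerr hm hx,
    atrChib_kerr hm hx, eta_kerr hm hx, etab_kerr hm hx, zeta_kerr hm hx, om_kerr hm hx,
    omb_kerr hm hx, hconn_kerr hm hx, scalar3_kerr hm hx, scalarDiv_kerr hm hx, scalar4,
    scalarH_kerr hm hx, coefThree, coefDiv]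
  simp only [Fin.sum_univ_two, eps, hz]
  simp [map_ofNat] at c12 c34 Vre Vim ⊢
  -- The second order discrepancy is ½[e_3, e_4] - i[e_1, e_2]: the first comes from symmetrising
  -- e_4 e_3, the second from expanding (e_1 + i e_2)(e_1 - i e_2).
  linear_combination (norm := skip) (1 / 2) * c34 - Complex.I * c12 + f x * Vre
    - 2 * Complex.I * f x * Vim
  ring_nf
  simp only [Complex.I_sq, Complex.I_pow_three]
  ring

end Kerr

/-! ### The classical Teukolsky equation -/

theorem along_along_mul {f h : Pt → ℂ} {x : Pt} (hf : ContDiffAt ℝ 2 f x) (hh : ContDiffAt ℝ 2 h x)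
    (X : VF) {Y : VF} (hY : ∀ l, DifferentiableAt ℝ (fun y => Y y l) x) :
    along X (along Y (fun y => h y * f y)) x =
      h x * along X (along Y f) x + along X h x * along Y f x
      + f x * along X (along Y h) x + along X f x * along Y h x := by
  have e : along Y (fun y => h y * f y) =ᶠ[𝓝 x] fun y => h y * along Y f y + f y * along Y h y := by
    filter_upwards [hf.eventually (by simp), hh.eventually (by simp)] with y h1 h2
    exact along_mul (h2.differentiableAt (by norm_num)) (h1.differentiableAt (by norm_num))
  have df := hf.differentiableAt (n := 2) (by norm_num)
  have dh := hh.differentiableAt (n := 2) (by norm_num)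
  have dYf := differentiableAt_along hf hY
  have dYh := differentiableAt_along hh hY
  rw [along_congr e, along_add (dh.fun_mul dYf) (df.fun_mul dYh), along_mul dh dYf,
    along_mul df dYh]
  ring

section Kerr

variable {m a : ℝ} {x : Pt} {f : Pt → ℂ}

/-- The phase `-q̄ / q` relating the tensorial and the Newman–Penrose components. -/
def phase (a : ℝ) (x : Pt) : ℂ := -((starRingEnd ℂ) (q a x) / q a x)

theorem conj_q (a : ℝ) (x : Pt) : (starRingEnd ℂ) (q a x) =
    (x 1 : ℂ) - Complex.I * ((a * Real.cos (x 2) : ℝ) : ℂ) := by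
  simp only [q, map_add, map_mul, Complex.conj_ofReal, Complex.conj_I]
  ring

theorem q_mul_conj (a : ℝ) (x : Pt) : q a x * (starRingEnd ℂ) (q a x) = (qSq a x : ℂ) := by
  rw [conj_q, q, qSq]
  push_cast
  linear_combination (-(a : ℂ) ^ 2 * Complex.cos (x 2) ^ 2) * Complex.I_sq

theorem q_ne_zero (hx : x ∈ patch m a) : q a x ≠ 0 := by
  intro h
  have := q_mul_conj a x
  rw [h, zero_mul] at this
  exact (qSq_pos hx).ne' (by exact_mod_cast this.symm)

theorem phase_ne_zero (hx : x ∈ patch m a) : phase a x ≠ 0 :=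
  neg_ne_zero.2 (div_ne_zero ((map_ne_zero _).2 (q_ne_zero hx)) (q_ne_zero hx))

theorem contDiffAt_phase (hx : x ∈ patch m a) : ContDiffAt ℝ 2 (phase a) x := by
  have hq : ContDiff ℝ 2 (q a) := by
    have h1 : ContDiff ℝ 2 fun y : Pt => y 1 := contDiff_apply _ _ 1
    have h2 : ContDiff ℝ 2 fun y : Pt => a * Real.cos (y 2) :=
      contDiff_const.mul (Real.contDiff_cos.comp (contDiff_apply _ _ 2))
    exact (Complex.ofRealCLM.contDiff.comp h1).add
      (contDiff_const.mul (Complex.ofRealCLM.contDiff.comp h2))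
  have e : phase a = fun y => -((starRingEnd ℂ) (q a y) * (q a y)⁻¹) :=
    funext fun y => by rw [phase, div_eq_mul_inv]
  rw [e]
  exact ((Complex.conjCLE.contDiff.comp hq).contDiffAt.mul
    (hq.contDiffAt.inv (q_ne_zero hx))).neg

/-- The logarithmic differential of q̄/q is (q dq̄ - q̄ dq)/|q|². Its r-part is (q - q̄)/|q|², and
its θ-part is i a sin θ (q + q̄)/|q|². -/
theorem hasGrad_phase (hx : x ∈ patch m a) : HasGrad (phase a)
    (2 * Complex.I * (coefB a x : ℂ) * phase a x)
    (2 * Complex.I * (qAbs a x : ℂ) * (coefW a x : ℂ) * phase a x) x := by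
  have hq0 := q_ne_zero hx
  have hS := (qSq_pos hx).ne'
  have hQ := (qAbs_pos hx).ne'
  have hac := ((hasGrad_const a x).mul (hasGrad_cos x)).ofReal
  have hq : HasGrad (q a) _ _ x := (hasGrad_r x).ofReal.add ((hasGrad_const Complex.I x).mul hac)
  have hqb : HasGrad (fun y => (starRingEnd ℂ) (q a y)) _ _ x :=
    ((hasGrad_r x).ofReal.sub ((hasGrad_const Complex.I x).mul hac)).congr_fun fun y => by
      rw [conj_q]
  have hqq := q_mul_conj a x
  have hcb : (starRingEnd ℂ) (q a x) ≠ 0 := (map_ne_zero _).2 hq0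
  have hB : (coefB a x : ℂ) =
      (a * Real.cos (x 2) : ℝ) / (q a x * (starRingEnd ℂ) (q a x)) := by
    rw [hqq, coefB]
    push_cast
    ring
  have hW : (qAbs a x : ℂ) * (coefW a x : ℂ) =
      (a * x 1 * Real.sin (x 2) : ℝ) / (q a x * (starRingEnd ℂ) (q a x)) := by
    rw [hqq, coefW, ← qAbs_sq hx, ← Complex.ofReal_mul, ← Complex.ofReal_div]
    congr 1
    field_simp
  refine (hqb.div hq hq0).neg.congr ?_ ?_
  · rw [hB, phase]
    field_simp
    rw [conj_q]
    simp [q]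
    ring
  · rw [mul_assoc (2 * Complex.I), hW, phase]
    field_simp
    rw [conj_q]
    simp [q]
    ring

theorem along_phase (hx : x ∈ patch m a) (i : Fin 4) : along (frame m a i) (phase a) x =
    ![2 * Complex.I * (coefW a x : ℂ), 0, -2 * Complex.I * ((coefD m a x * coefB a x : ℝ) : ℂ),
      2 * Complex.I * (coefB a x : ℂ)] i * phase a x := by
  have hQ : (qAbs a x : ℂ) ≠ 0 := by exact_mod_cast (qAbs_pos hx).ne'
  rw [(hasGrad_phase hx).along]
  fin_cases i
  · simp [frame]
    field_simp
  · simp [frame]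
  · simp [frame, coefD]
    ring
  · simp [frame]

/-- With e_i p = k_i p for explicit k_i, second derivatives are e_i e_j p = (e_i k_j + k_i k_j) p,
so p factors out of the wave operator. -/
theorem box_phase (hm : 0 ≤ m) (hx : x ∈ patch m a) : box (kerr m a) (phase a) x =
    (2 * Complex.I * (coefW_theta a x / qAbs a x : ℝ) - 4 * (coefW a x : ℂ) ^ 2
      + 2 * Complex.I * (coefD m a x * coefB_r a x + coefO m a x * coefB a x : ℝ)
      - 4 * (coefD m a x : ℂ) * (coefB a x : ℂ) ^ 2
      + 2 * Complex.I * ((Lam a x - 2 * coefU a x) * coefW a x : ℝ)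
      + 2 * Complex.I * (coefA a x * coefD m a x * coefB a x : ℝ)
      + 2 * Complex.I * ((coefD m a x * coefA a x + coefO m a x) * coefB a x : ℝ))
      * phase a x := by
  have hp := contDiffAt_phase hx
  have dp := hp.differentiableAt (n := 2) (by norm_num)
  have key (i j : Fin 4) {k : Pt → ℂ} {u v : ℂ} (hk : HasGrad k u v x)
      (h : ∀ y ∈ patch m a, along (frame m a j) (phase a) y = k y * phase a y) :
      along (frame m a i) (along (frame m a j) (phase a)) x =
        k x * along (frame m a i) (phase a) x +
          phase a x * (frame m a i x 1 • u + frame m a i x 2 • v) := by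
    rw [along_congr (h := fun y => k y * phase a y) ((eventually_patch hx).mono h),
      along_mul hk.differentiableAt dp, hk.along]
  have k0 := (hasGrad_const (2 * Complex.I) x).mul (hasGrad_coefW hx).ofReal
  have k2 := (hasGrad_const (-2 * Complex.I) x).mul
    ((hasGrad_coefD hx).mul (hasGrad_coefB hx)).ofReal
  have k3 := (hasGrad_const (2 * Complex.I) x).mul (hasGrad_coefB hx).ofReal
  rw [box_kerr hm hx hp, key 0 0 k0 fun y hy => along_phase hy 0,
    key 1 1 (hasGrad_const 0 x) fun y hy => along_phase hy 1,
    key 2 3 k3 fun y hy => along_phase hy 3, key 3 2 k2 fun y hy => along_phase hy 2]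
  simp only [along_phase hx]
  simp [frame]
  rw [coefD]
  push_cast
  ring_nf
  simp only [Complex.I_sq]
  ring

/-- The cross term of the Leibniz rule is 2 g⁻¹(dp, df); its e_2 part is absent because e_2 p = 0.
-/
theorem box_mul_phase (hm : 0 ≤ m) (hx : x ∈ patch m a) (hf : ContDiffAt ℝ 2 f x) :
    box (kerr m a) (fun y => phase a y * f y) x =
      phase a x * box (kerr m a) f x + f x * box (kerr m a) (phase a) x +
      2 * Complex.I * phase a x * (2 * (coefW a x : ℂ) * along (frame m a 0) f x +
        (coefD m a x * coefB a x : ℝ) * along (frame m a 3) f x -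
        (coefB a x : ℂ) * along (frame m a 2) f x) := by
  have hp := contDiffAt_phase hx
  have dp := hp.differentiableAt (n := 2) (by norm_num)
  have df := hf.differentiableAt (n := 2) (by norm_num)
  have hd (i l : Fin 4) := (hasGrad_frame hx i l).differentiableAt
  rw [box_kerr hm hx (hp.mul hf), box_kerr hm hx hf, box_kerr hm hx hp]
  simp only [along_along_mul hf hp _ (hd _), along_mul dp df, along_phase hx]
  simp
  ring

theorem along_frame_coord (i : Fin 4) : along (frame m a i) f x =
    ![((1 / qAbs a x : ℝ) : ℂ) * pd 2 f x,
      ((a * Real.sin (x 2) / qAbs a x : ℝ) : ℂ) * pd 0 f x +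
        ((1 / (qAbs a x * Real.sin (x 2)) : ℝ) : ℂ) * pd 3 f x,
      (((x 1 ^ 2 + a ^ 2) / qSq a x : ℝ) : ℂ) * pd 0 f x - (coefD m a x : ℂ) * pd 1 f x +
        ((a / qSq a x : ℝ) : ℂ) * pd 3 f x,
      (((x 1 ^ 2 + a ^ 2) / Del m a x : ℝ) : ℂ) * pd 0 f x + pd 1 f x +
        ((a / Del m a x : ℝ) : ℂ) * pd 3 f x] i := by
  fin_cases i <;> simp [along, Fin.sum_univ_four, frame, coefD] <;> ring

/-- First of seven coefficient comparisons for `teukolsky_phase`, for ∂_r, ∂_t, ∂_φ and order zero,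
split into real and imaginary parts. The imaginary part for ∂_r and the whole ∂_θ coefficient cancel
identically and need no lemma. -/
theorem coeff_r (hx : x ∈ patch m a) : 4 * (x 1 - m) + qSq a x * (-4 * coefO m a x
    - 4 * coefD m a x * coefA a x) = 0 := by
  have hS := (qSq_pos hx).ne'
  simp only [coefO, coefD, coefA]
  field_simp
  ring

theorem coeff_t_re (hx : x ∈ patch m a) : 4 * (m * (x 1 ^ 2 - a ^ 2) / Del m a x - x 1)
    + qSq a x * (-4 * coefO m a x * ((x 1 ^ 2 + a ^ 2) / Del m a x)
      + 4 * coefA a x * ((x 1 ^ 2 + a ^ 2) / qSq a x)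
      - 8 * coefW a x * (a * Real.sin (x 2) / qAbs a x)) = 0 := by
  have hD0 := Del_ne_zero hx
  have hQ := (qAbs_pos hx).ne'
  have hQ2 := qAbs_sq hx
  have hD : Del m a x = x 1 ^ 2 - 2 * m * x 1 + a ^ 2 := rfl
  obtain ⟨p2, p4, s2, s4⟩ := even_powers hx
  simp only [coefO, coefA, coefW, ← hQ2]
  field_simp
  rw [hD]
  ring_nf
  simp only [p2, s2]
  ring

theorem coeff_t_im (hx : x ∈ patch m a) : -4 * (a * Real.cos (x 2))
    + qSq a x * (2 * coefD m a x * coefB a x * ((x 1 ^ 2 + a ^ 2) / Del m a x)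
      + 6 * coefB a x * ((x 1 ^ 2 + a ^ 2) / qSq a x)
      - 4 * (Lam a x + coefU a x) * (a * Real.sin (x 2) / qAbs a x)) = 0 := by
  have hD0 := Del_ne_zero hx
  have hQ := (qAbs_pos hx).ne'
  have hs := (sin_pos_of_mem hx).ne'
  have hQ2 := qAbs_sq hx
  obtain ⟨p2, p4, s2, s4⟩ := even_powers hx
  simp only [coefD, coefB, coefU, Lam_eq, ← hQ2]
  field_simp
  ring_nf
  simp only [p2, s2]
  ring

theorem coeff_phi_re (hx : x ∈ patch m a) : 4 * (a * (x 1 - m) / Del m a x)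
    + qSq a x * (-4 * coefO m a x * (a / Del m a x) + 4 * coefA a x * (a / qSq a x)
      - 8 * coefW a x * (1 / (qAbs a x * Real.sin (x 2)))) = 0 := by
  have hD0 := Del_ne_zero hx
  have hQ := (qAbs_pos hx).ne'
  have hs := (sin_pos_of_mem hx).ne'
  have hQ2 := qAbs_sq hx
  simp only [coefO, coefA, coefW, ← hQ2]
  field_simp
  ring

theorem coeff_phi_im (hx : x ∈ patch m a) : 4 * (Real.cos (x 2) / Real.sin (x 2) ^ 2)
    + qSq a x * (2 * coefD m a x * coefB a x * (a / Del m a x) + 6 * coefB a x * (a / qSq a x)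
      - 4 * (Lam a x + coefU a x) * (1 / (qAbs a x * Real.sin (x 2)))) = 0 := by
  have hD0 := Del_ne_zero hx
  have hQ := (qAbs_pos hx).ne'
  have hs := (sin_pos_of_mem hx).ne'
  have hQ2 := qAbs_sq hx
  obtain ⟨p2, p4, s2, s4⟩ := even_powers hx
  simp only [coefD, coefB, coefU, Lam_eq, ← hQ2]
  field_simp
  ring_nf
  simp only [p2, s2]
  ring

theorem coeff_zero_re (hm : 0 ≤ m) (hx : x ∈ patch m a) :
    qSq a x * (-20 * coefW a x ^ 2 - 14 * coefD m a x * coefB a x ^ 2 + 4 * Lam a x ^ 2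
      - 2 * coefD m a x * coefA a x ^ 2 - 20 * coefA a x * coefO m a x
      - 8 * rho (kerr m a) (frame m a) x - 2 * (coefU_theta a x / qAbs a x)
      + 6 * Lam a x * coefU a x + 8 * coefU a x ^ 2) - (4 * Real.cot (x 2) ^ 2 - 2) = 0 := by
  have hQ := (qAbs_pos hx).ne'
  have hs := (sin_pos_of_mem hx).ne'
  have hQ2 := qAbs_sq hx
  have hD : Del m a x = x 1 ^ 2 - 2 * m * x 1 + a ^ 2 := rfl
  obtain ⟨p2, p4, s2, s4⟩ := even_powers hx
  rw [rho_kerr hm hx]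
  simp only [coefW, coefD, coefB, coefA, coefO, coefU, coefU_theta, Lam_eq, ← hQ2, hD,
    Real.cot_eq_cos_div_sin]
  field_simp
  ring_nf
  simp only [p2, p4, s2, s4]
  ring

theorem coeff_zero_im (hm : 0 ≤ m) (hx : x ∈ patch m a) :
    qSq a x * (2 * (coefW_theta a x / qAbs a x) + 2 * coefD m a x * coefB_r a x
      - 16 * coefO m a x * coefB a x - 10 * Lam a x * coefW a x - 12 * coefU a x * coefW a x
      + 4 * coefA a x * coefD m a x * coefB a x + 4 * rhoDual (kerr m a) (frame m a) x)
      + 8 * (x 1 - m) * coefB a x = 0 := by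
  have hQ := (qAbs_pos hx).ne'
  have hs := (sin_pos_of_mem hx).ne'
  have hQ2 := qAbs_sq hx
  have hD : Del m a x = x 1 ^ 2 - 2 * m * x 1 + a ^ 2 := rfl
  obtain ⟨p2, p4, s2, s4⟩ := even_powers hx
  rw [rhoDual_kerr hm hx]
  simp only [coefW, coefD, coefB, coefA, coefO, coefU, coefW_theta, coefB_r, Lam_eq, ← hQ2, hD]
  field_simp
  ring_nf
  simp only [p2, s2]
  ring

/-- An identity of operators, valid whether or not f solves an equation: conjugation by the phase
carries the scalar operator to the classical one. -/
theorem teukolsky_phase (hm : 0 ≤ m) (hx : x ∈ patch m a) (hf : ContDiffAt ℝ 2 f x) :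
    (qSq a x : ℂ) * box (kerr m a) (alphaOf a f) x - teukolskyRHS m a (alphaOf a f) x =
      (qSq a x : ℂ) * phase a x * (box (kerr m a) f x - waveRHS m a f x) := by
  have df := hf.differentiableAt (n := 2) (by norm_num)
  have gp := hasGrad_phase hx
  have e : alphaOf a f = fun y => phase a y * f y := rfl
  have eU : along (frame m a 0) (etab (kerr m a) (frame m a) 0) x =
      -(coefU_theta a x / qAbs a x) := along_etab_kerr hm hx
  have c1 := congrArg (fun t : ℝ => (t : ℂ)) (coeff_r hx)
  have c0r := congrArg (fun t : ℝ => (t : ℂ)) (coeff_t_re hx)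
  have c0i := congrArg (fun t : ℝ => (t : ℂ)) (coeff_t_im hx)
  have c3r := congrArg (fun t : ℝ => (t : ℂ)) (coeff_phi_re hx)
  have c3i := congrArg (fun t : ℝ => (t : ℂ)) (coeff_phi_im hx)
  have vr := congrArg (fun t : ℝ => (t : ℂ)) (coeff_zero_re hm hx)
  have vi := congrArg (fun t : ℝ => (t : ℂ)) (coeff_zero_im hm hx)
  rw [e, box_mul_phase hm hx hf, box_phase hm hx]
  simp only [teukolskyRHS, pd_mul gp.differentiableAt df, gp.pd, waveRHS, potV, potRe, potIm,
    trChi_kerr hm hx, atrChi_kerr hm hx, trChib_kerr hm hx, atrChib_kerr hm hx, etab_kerr hm hx,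
    omb_kerr hm hx, eU, along_frame_coord]
  -- The ∂_t and ∂_φ components of (Δ/|q|²) e_4 agree with those of e_3; this relation merges the
  -- two contributions to the imaginary parts.
  have hD : (coefD m a x : ℂ) * (Del m a x : ℂ)⁻¹ = (qSq a x : ℂ)⁻¹ := by
    have h1 : (Del m a x : ℂ) ≠ 0 := by exact_mod_cast Del_ne_zero hx
    have h2 : (qSq a x : ℂ) ≠ 0 := by exact_mod_cast (qSq_pos hx).ne'
    rw [coefD]
    push_cast
    field_simp
  simp only [Matrix.cons_val]
  push_cast at c1 c0r c0i c3r c3i vr vi ⊢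
  linear_combination phase a x * (pd 1 f x * c1 +
    pd 0 f x * (c0r + Complex.I * c0i) + pd 3 f x * (c3r + Complex.I * c3i) +
    f x * (vr + Complex.I * vi)) + 2 * (qSq a x : ℂ) * phase a x * Complex.I * (coefB a x : ℂ) *
      (((x 1 : ℂ) ^ 2 + (a : ℂ) ^ 2) * pd 0 f x + (a : ℂ) * pd 3 f x) * hD

end Kerr

/-! ### Null components of Weyl tensors -/

section Weyl

variable {W : Fin 4 → Fin 4 → Fin 4 → Fin 4 → ℝ}

theorem evalC_add_smul (X Y Z : Fin 4 → ℂ) (k : ℂ) :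
    evalC W X (fun μ => k * (Y μ + Complex.I * Z μ)) X (fun μ => k * (Y μ + Complex.I * Z μ)) =
      k ^ 2 * (evalC W X Y X Y - evalC W X Z X Z
        + Complex.I * (evalC W X Y X Z + evalC W X Z X Y)) := by
  simp only [evalC, mul_add, mul_sub, Finset.mul_sum, ← Finset.sum_add_distrib,
    ← Finset.sum_sub_distrib]
  refine Finset.sum_congr rfl fun α _ => Finset.sum_congr rfl fun β _ =>
    Finset.sum_congr rfl fun μ _ => Finset.sum_congr rfl fun ν _ => ?_
  linear_combination ((W α β μ ν : ℂ) * X α * X μ * k ^ 2 * Z β * Z ν) * Complex.I_sq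

theorem evalC_pair_symm (h : ∀ α β μ ν, W α β μ ν = W μ ν α β) (X Y Z T : Fin 4 → ℂ) :
    evalC W X Y Z T = evalC W Z T X Y := by
  simp only [evalC]
  rw [Finset.sum_congr rfl fun α _ => Finset.sum_comm, Finset.sum_comm]
  refine Finset.sum_congr rfl fun μ _ => ?_
  rw [Finset.sum_congr rfl fun α _ => Finset.sum_comm, Finset.sum_comm]
  refine Finset.sum_congr rfl fun ν _ => Finset.sum_congr rfl fun α _ =>
    Finset.sum_congr rfl fun β _ => ?_
  rw [h α β μ ν]
  ring

theorem evalC_self_left (h : ∀ α β μ ν, W α β μ ν = -W β α μ ν) (X Z T : Fin 4 → ℂ) :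
    evalC W X X Z T = 0 := by
  have : evalC W X X Z T = -evalC W X X Z T := by
    conv_lhs => rw [evalC, Finset.sum_comm]
    simp only [evalC, ← Finset.sum_neg_distrib]
    refine Finset.sum_congr rfl fun α _ => Finset.sum_congr rfl fun β _ =>
      Finset.sum_congr rfl fun μ _ => Finset.sum_congr rfl fun ν _ => ?_
    rw [h β α μ ν]
    push_cast
    ring
  linear_combination (1 / 2) * this

/-- The coordinate trace condition becomes a frame trace on inserting the frame expansion of g⁻¹. -/
theorem IsWeyl.trace_frame {g : Metric} {e : Fin 4 → VF} {x : Pt}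
    (hgr : ∀ i j, ip g (e i) (e j) x = nullGram i j) (hW : IsWeyl (g x) W) (X Z : Fin 4 → ℂ) :
    evalC W X (toC (e 0 x)) Z (toC (e 0 x)) + evalC W X (toC (e 1 x)) Z (toC (e 1 x))
      - (1 / 2) * (evalC W X (toC (e 2 x)) Z (toC (e 3 x)) +
        evalC W X (toC (e 3 x)) Z (toC (e 2 x))) = 0 := by
  have h1 : ∑ i, ∑ j, (nullGramInv i j : ℂ) * evalC W X (toC (e i x)) Z (toC (e j x)) =
      ∑ α, ∑ μ, X α * Z μ * ((∑ β, ∑ ν, (g x)⁻¹ β ν * W α β μ ν : ℝ) : ℂ) := by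
    simp only [metric_inv_apply hgr, evalC, toC]
    push_cast
    simp only [Finset.mul_sum, Finset.sum_mul]
    have hc (T : Fin 4 → Fin 4 → Fin 4 → Fin 4 → ℂ) :
        ∑ i, ∑ j, ∑ α, ∑ β, T i j α β = ∑ α, ∑ β, ∑ i, ∑ j, T i j α β := by
      rw [Finset.sum_congr rfl fun i _ => Finset.sum_comm, Finset.sum_comm]
      refine Finset.sum_congr rfl fun α _ => ?_
      rw [Finset.sum_congr rfl fun i _ => Finset.sum_comm, Finset.sum_comm]
    rw [hc]
    refine Finset.sum_congr rfl fun α _ => ?_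
    rw [Finset.sum_congr rfl fun β _ => hc _, Finset.sum_comm]
    refine Finset.sum_congr rfl fun μ _ => Finset.sum_congr rfl fun β _ =>
      Finset.sum_congr rfl fun ν _ => Finset.sum_congr rfl fun i _ =>
      Finset.sum_congr rfl fun j _ => ?_
    ring
  simp only [hW.trace_free] at h1
  simp [Fin.sum_univ_four, nullGramInv] at h1
  linear_combination h1

end Weyl

/-- Tracing against e_4, e_4 kills the (e_3, e_4) terms by skewness and leaves α_11 + α_22 = 0, and
pair symmetry gives α_12 = α_21. Expanding n = k(e_1 + i e_2) then yields 2k²(α_11 + i α_12). -/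
theorem alphaNP_eq {m a : ℝ} (hm : 0 ≤ m) {x : Pt} (hx : x ∈ patch m a)
    {W : Fin 4 → Fin 4 → Fin 4 → Fin 4 → ℝ} (hW : IsWeyl (kerr m a x) W) :
    alphaNP m a W x = -((starRingEnd ℂ) (q a x) / q a x) * nullA (frame m a) W x 0 0 := by
  have h1 := hW.trace_frame (fun i j => ip_frame hm hx i j) (toC (frame m a 3 x))
    (toC (frame m a 3 x))
  rw [evalC_self_left hW.antisymm_left, evalC_pair_symm hW.pair_symm _ (toC (frame m a 2 x)),
    evalC_self_left hW.antisymm_left] at h1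
  have h2 := evalC_pair_symm hW.pair_symm (toC (frame m a 3 x)) (toC (frame m a 0 x))
    (toC (frame m a 3 x)) (toC (frame m a 1 x))
  have h3 := evalC_add_smul (W := W) (toC (frame m a 3 x)) (toC (frame m a 0 x))
    (toC (frame m a 1 x)) ((qAbs a x : ℂ) / ((√2 : ℝ) * q a x))
  have hq := q_ne_zero hx
  -- Since |q|² = q q̄, squaring the normalising factor cancels one power of q.
  have hk : ((qAbs a x : ℂ) / ((√2 : ℝ) * q a x)) ^ 2 =
      (starRingEnd ℂ) (q a x) / (2 * q a x) := by
    have e1 : ((√2 : ℝ) : ℂ) ^ 2 = 2 := by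
      rw [← Complex.ofReal_pow, Real.sq_sqrt (by norm_num)]
      norm_num
    have e2 : (qAbs a x : ℂ) ^ 2 = q a x * (starRingEnd ℂ) (q a x) := by
      rw [q_mul_conj, ← Complex.ofReal_pow, qAbs_sq hx]
    rw [div_pow, mul_pow, e1, e2]
    field_simp
  change -evalC W (toC (frame m a 3 x)) (fun μ => (qAbs a x : ℂ) / ((√2 : ℝ) * q a x) *
    (toC (frame m a 0 x) μ + Complex.I * toC (frame m a 1 x) μ)) (toC (frame m a 3 x))
    (fun μ => (qAbs a x : ℂ) / ((√2 : ℝ) * q a x) *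
    (toC (frame m a 0 x) μ + Complex.I * toC (frame m a 1 x) μ)) = _
  rw [h3, hk]
  simp only [nullA, Fin.sum_univ_two, eps, hz]
  simp
  rw [h2]
  field_simp
  linear_combination (-(starRingEnd ℂ) (q a x)) * h1

end KerrTeukolsky

end

/-! ### Assembly of the four claims. -/

open KerrTeukolsky in
theorem mainTheorem7 (m a : ℝ) (hm : 0 ≤ m) (U : Set (Fin 4 → ℝ)) (hU : IsOpen U)
    (hUpatch : U ⊆ patch m a) (A : HTensor)
    (hA : ∀ x ∈ U, IsAntiSelfDual (A x))
    (hreg : ∀ b c : Fin 2, ContDiffOn ℝ 2 (fun x => A x b c) U) :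
    (∀ x ∈ U, teukolskyOp (kerr m a) (frame m a) A x 0 0 =
      box (kerr m a) (fun y => A y 0 0) x - waveRHS m a (fun y => A y 0 0) x) ∧
    ((∀ x ∈ U, ∀ b c : Fin 2, teukolskyOp (kerr m a) (frame m a) A x b c = 0) ↔
      ∀ x ∈ U, box (kerr m a) (fun y => A y 0 0) x = waveRHS m a (fun y => A y 0 0) x) ∧
    (∀ x ∈ U, box (kerr m a) (fun y => A y 0 0) x = waveRHS m a (fun y => A y 0 0) x ↔
      ((qSq a x : ℝ) : ℂ) * box (kerr m a) (alphaOf a (fun y => A y 0 0)) x =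
        teukolskyRHS m a (alphaOf a (fun y => A y 0 0)) x) ∧
    (∀ x ∈ U, ∀ W : Fin 4 → Fin 4 → Fin 4 → Fin 4 → ℝ, IsWeyl (kerr m a x) W →
      alphaNP m a W x =
        -((starRingEnd ℂ) (q a x) / q a x) * nullA (frame m a) W x 0 0) := by
  have hf : ∀ x ∈ U, ContDiffAt ℝ 2 (fun y => A y 0 0) x := fun x hx =>
    (hreg 0 0).contDiffAt (hU.mem_nhds hx)
  -- All components are constant multiples of one scalar, and the (1,1) multiple is 1. This gives
  -- both the formula and the equivalence of the tensor and scalar equations.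
  have key : ∀ x ∈ U, ∀ b c, teukolskyOp (kerr m a) (frame m a) A x b c =
      (box (kerr m a) (fun y => A y 0 0) x - waveRHS m a (fun y => A y 0 0) x) *
        asdTensor b c := by
    intro x hx b c
    rw [← teukolskyScalar_kerr hm (hUpatch hx) (hf x hx)]
    have hn : ∀ᶠ y in nhds x, y ∈ U := hU.mem_nhds hx
    exact teukolskyOp_asd
      (hn.mono fun y hy => (hf y hy).differentiableAt (by norm_num))
      (differentiableAt_scalar3 hm (hUpatch hx) (hf x hx))
      (differentiableAt_scalarDiv hm (hUpatch hx) (hf x hx))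
      (hn.mono fun y hy => (hA y hy).eq_smul)
      (hn.mono fun y hy => hconn_kerr_antisymm hm (hUpatch hy)) b c
  refine ⟨fun x hx => ?_, ⟨fun h x hx => ?_, fun h x hx b c => ?_⟩, fun x hx => ?_,
    fun x hx W hW => alphaNP_eq hm (hUpatch hx) hW⟩
  · rw [key x hx]
    simp [asdTensor]
  · have := key x hx 0 0
    rw [h x hx 0 0] at this
    exact sub_eq_zero.1 (by simpa [asdTensor] using this.symm)
  · rw [key x hx, h x hx, sub_self, zero_mul]
  · have h1 := teukolsky_phase hm (hUpatch hx) (hf x hx)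
    -- The two scalar equations differ by this nonvanishing factor, which makes the equivalence
    -- pointwise.
    have h2 : (qSq a x : ℂ) * phase a x ≠ 0 :=
      mul_ne_zero (by exact_mod_cast (qSq_pos (hUpatch hx)).ne') (phase_ne_zero (hUpatch hx))
    rw [← sub_eq_zero, ← sub_eq_zero (a := _ * box _ _ _), h1, mul_eq_zero, or_iff_right h2]
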